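/- Let $n,m\ge 0$ be integers and let $f=(f_{i_1\cdots i_m})$ be a symmetric $m$-tensor field on $\mathbb{R}^n$ whose components are compactly supported complex distributions, $f\in\mathcal{E}'(\mathbb{R}^n;S^m)$. Use the following notation. The operator $R$ is $$(Rf)_{i_1j_1\cdots i_mj_m}=\alpha(i_1j_1)\cdots\alpha(i_mj_m)\,\frac{\partial^m f_{i_1\cdots i_m}}{\partial x_{j_1}\cdots\partial x_{j_m}},$$ where $\alpha(i_pj_p)$ is the alternation $\alpha(i_pj_p)u_{\cdots i_p j_p\cdots}=\tfrac12(u_{\cdots i_pj_p\cdots}-u_{\cdots j_pi_p\cdots})$. Further, $i$ is the symmetrized multiplication of tensors by the Euclidean metric, $(i u)_{i_1\cdots i_{k+2}}=\sigma(i_1\cdots i_{k+2})\,\delta_{i_1i_2}u_{i_3\cdots i_{k+2}}$, with $\sigma$ the average over all permutations of the indices, and $j$ is the contraction $(ju)_{i_1\cdots i_k}=\sum_{p=1}^n u_{i_1\cdots i_kpp}$. For smooth compactly supported $m$-tensor fields $\varphi$ the ray transform is $I_m\varphi(x,\xi)=\int_{\mathbb{R}}\varphi_{i_1\cdots i_m}(x+t\xi)\,\xi_{i_1}\cdots\xi_{i_m}\,dt$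 (summation over repeated indices) on $T\mathbb{S}^{n-1}=\{(x,\xi):|\xi|=1,\ \langle x,\xi\rangle=0\}$, its formal adjoint is $(I_m^*g)_{i_1\cdots i_m}(x)=\int_{\mathbb{S}^{n-1}}\xi_{i_1}\cdots\xi_{i_m}\,g(x-\langle x,\xi\rangle\xi,\xi)\,dS_\xi$ with $dS_\xi$ the Euclidean surface measure, and $N_m=I_m^*I_m$. The operator $N_m:\mathcal{E}'(\mathbb{R}^n;S^m)\to\mathcal{D}'(\mathbb{R}^n;S^m)$ is the extension by duality, $\langle N_mf,\varphi\rangle=\langle f,N_m\varphi\rangle$. Then for all indices $i_1,j_1,\dots,i_m,j_m\in\{1,\dots,n\}$, as distributions on $\mathbb{R}^n$, $$m!\,N_0\big((Rf)_{i_1j_1\cdots i_mj_m}\big)=\sum_{l=0}^{\lfloor m/2\rfloor}c_{l,m}\,\big(R(i^l j^l N_mf)\big)_{i_1j_1\cdots i_mj_m},$$ where $$c_{l,m}=\Big\{\prod_{p=0}^{m-l-1}(n-1+2p)\Big\}\,\frac{(-1)^l\,m!}{2^l\,l!\,(m-2l)!}.$$ -/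

import Mathlib

open MeasureTheory TopologicalSpace Distribution LineDeriv
open scoped Distributions ContDiff Topology

/-- `ℝⁿ` with its Euclidean structure. -/
abbrev Euc (n : ℕ) := EuclideanSpace ℝ (Fin n)

/-- Components `u_{i₁ … i_m}` of a covariant tensor field of order `m` on `ℝⁿ`, the components
being objects of type `D` (functions, distributions, …). -/
abbrev TensorField (n m : ℕ) (D : Type*) := (Fin m → Fin n) → D

namespace RayTensor

variable {n : ℕ}

/-- Unit sphere `S^{n-1}`. -/
abbrev USphere (n : ℕ) := Metric.sphere (0 : Euc n) 1

/-- Euclidean surface measure on the unit sphere. -/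
noncomputable abbrev sphereMeasure (n : ℕ) : Measure (USphere n) :=
  (volume : Measure (Euc n)).toSphere

/-- The weighted average of `g` over all lines through `x`. -/
noncomputable def lineAvg {G : Type*} [NormedAddCommGroup G] [NormedSpace ℝ G]
    (w : USphere n → ℝ) (g : Euc n → G) (x : Euc n) : G :=
  ∫ p : USphere n × ℝ, w p.1 • g (x + p.2 • (p.1 : Euc n)) ∂((sphereMeasure n).prod volume)

section lineAvg

variable {G : Type*} [NormedAddCommGroup G] [NormedSpace ℝ G]

theorem lineAvg_integrand_le {w : USphere n → ℝ} {g : Euc n → G} {B M R r : ℝ}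
    (hw : ∀ ξ, |w ξ| ≤ B) (hM : ∀ y, ‖g y‖ ≤ M) (hR : ∀ y, R < ‖y‖ → g y = 0)
    {x : Euc n} (hx : ‖x‖ ≤ r) (p : USphere n × ℝ) :
    ‖w p.1 • g (x + p.2 • (p.1 : Euc n))‖ ≤
      (Set.univ ×ˢ Set.Icc (-(R + r)) (R + r)).indicator (fun _ => B * M) p := by
  have hB : 0 ≤ B := (abs_nonneg _).trans (hw p.1)
  have hn : ‖(p.1 : Euc n)‖ = 1 := by simp
  by_cases hp : p ∈ (Set.univ ×ˢ Set.Icc (-(R + r)) (R + r) : Set (USphere n × ℝ))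
  · rw [Set.indicator_of_mem hp, norm_smul, Real.norm_eq_abs]
    exact mul_le_mul (hw _) (hM _) (norm_nonneg _) hB
  · rw [Set.indicator_of_notMem hp, hR, smul_zero, norm_zero]
    have hp' : R + r < |p.2| := by
      by_contra h
      exact hp ⟨trivial, abs_le.1 (not_lt.1 h)⟩
    have h1 : ‖p.2 • (p.1 : Euc n)‖ = |p.2| := by rw [norm_smul, hn, mul_one, Real.norm_eq_abs]
    have h2 := norm_sub_le (x + p.2 • (p.1 : Euc n)) x
    rw [add_sub_cancel_left, h1] at h2
    linarith

theorem lineAvg_bound_integrable (c a : ℝ) :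
    Integrable ((Set.univ ×ˢ Set.Icc (-a) a : Set (USphere n × ℝ)).indicator (fun _ => c))
      ((sphereMeasure n).prod volume) := by
  rw [integrable_indicator_iff (MeasurableSet.univ.prod measurableSet_Icc)]
  refine integrableOn_const ?_
  rw [Measure.prod_prod]
  exact (ENNReal.mul_lt_top (measure_lt_top _ _) (by simp)).ne

theorem lineAvg_aesm {w : USphere n → ℝ} (hw : Continuous w) {g : Euc n → G} (hg : Continuous g)
    (x : Euc n) : AEStronglyMeasurable
      (fun p : USphere n × ℝ => w p.1 • g (x + p.2 • (p.1 : Euc n)))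
      ((sphereMeasure n).prod volume) := by
  have : Continuous (fun p : USphere n × ℝ => w p.1 • g (x + p.2 • (p.1 : Euc n))) := by
    fun_prop
  exact this.aestronglyMeasurable

theorem lineAvg_integrable {w : USphere n → ℝ} (hw : Continuous w) {B M R : ℝ}
    (hB : ∀ ξ, |w ξ| ≤ B) {g : Euc n → G} (hg : Continuous g) (hM : ∀ y, ‖g y‖ ≤ M)
    (hR : ∀ y, R < ‖y‖ → g y = 0) (x : Euc n) : Integrable
      (fun p : USphere n × ℝ => w p.1 • g (x + p.2 • (p.1 : Euc n)))
      ((sphereMeasure n).prod volume) :=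
  (lineAvg_bound_integrable _ _).mono' (lineAvg_aesm hw hg x)
    (.of_forall fun p => lineAvg_integrand_le hB hM hR le_rfl p)

theorem norm_lineAvg_le {w : USphere n → ℝ} {g : Euc n → G} {B M R r : ℝ}
    (hw : ∀ ξ, |w ξ| ≤ B) (hM : ∀ y, ‖g y‖ ≤ M) (hR : ∀ y, R < ‖y‖ → g y = 0)
    {x : Euc n} (hx : ‖x‖ ≤ r) :
    ‖lineAvg w g x‖ ≤ (((sphereMeasure n).prod volume).real
      (Set.univ ×ˢ Set.Icc (-(R + r)) (R + r)) * B) * M := by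
  refine (norm_integral_le_of_norm_le (lineAvg_bound_integrable (B * M) (R + r))
    (.of_forall fun p => lineAvg_integrand_le hw hM hR hx p)).trans ?_
  rw [integral_indicator_const _ (MeasurableSet.univ.prod measurableSet_Icc), smul_eq_mul,
    mul_assoc]

theorem fderiv_eq_zero_of_lt {g : Euc n → G} {R : ℝ} (hR : ∀ y, R < ‖y‖ → g y = 0) :
    ∀ y, R < ‖y‖ → fderiv ℝ g y = 0 := by
  intro y hy
  have : g =ᶠ[𝓝 y] fun _ => 0 := by
    filter_upwards [(isOpen_lt continuous_const continuous_norm).mem_nhds hy] with z hz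
    exact hR z hz
  rw [this.fderiv_eq]; simp

theorem exists_norm_bound {G : Type*} [NormedAddCommGroup G] {g : Euc n → G} {R : ℝ} (hg : Continuous g)
    (hR : ∀ y, R < ‖y‖ → g y = 0) : ∃ M, ∀ y, ‖g y‖ ≤ M := by
  have : HasCompactSupport g := by
    refine HasCompactSupport.intro (isCompact_closedBall (0 : Euc n) R) fun y hy => hR y ?_
    simpa using hy
  exact hg.bounded_above_of_compact_support this

theorem hasFDerivAt_lineAvg {w : USphere n → ℝ} (hw : Continuous w) {B R : ℝ}
    (hB : ∀ ξ, |w ξ| ≤ B) {g : Euc n → G} (hg : ContDiff ℝ 1 g)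
    (hR : ∀ y, R < ‖y‖ → g y = 0) (x : Euc n) :
    HasFDerivAt (lineAvg w g) (lineAvg w (fderiv ℝ g) x) x := by
  obtain ⟨M, hM⟩ := exists_norm_bound hg.continuous hR
  have hg' : Continuous (fderiv ℝ g) := hg.continuous_fderiv one_ne_zero
  obtain ⟨M', hM'⟩ := exists_norm_bound hg' (fderiv_eq_zero_of_lt hR)
  refine hasFDerivAt_integral_of_dominated_of_fderiv_le
    (F' := fun x (p : USphere n × ℝ) => w p.1 • fderiv ℝ g (x + p.2 • (p.1 : Euc n)))
    (bound := (Set.univ ×ˢ Set.Icc (-(R + (‖x‖ + 1))) (R + (‖x‖ + 1)) :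
      Set (USphere n × ℝ)).indicator (fun _ => B * M'))
    (Metric.ball_mem_nhds x one_pos) (.of_forall fun y => lineAvg_aesm hw hg.continuous y)
    (lineAvg_integrable hw hB hg.continuous hM hR x) (lineAvg_aesm hw hg' x)
    (.of_forall fun p y hy => ?_) (lineAvg_bound_integrable _ _) (.of_forall fun p y hy => ?_)
  · refine lineAvg_integrand_le hB hM' (fderiv_eq_zero_of_lt hR) ?_ p
    have := norm_sub_norm_le y x
    have h2 : ‖y - x‖ < 1 := by simpa [dist_eq_norm] using hy
    linarith
  · have h := (hg.differentiable one_ne_zero (y + p.2 • (p.1 : Euc n))).hasFDerivAt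
    have h2 : HasFDerivAt (fun z : Euc n => z + p.2 • (p.1 : Euc n))
        (ContinuousLinearMap.id ℝ (Euc n)) y := (hasFDerivAt_id y).add_const _
    have h3 := (h.comp y h2).const_smul (w p.1)
    rw [ContinuousLinearMap.comp_id] at h3
    exact h3

theorem fderiv_lineAvg {w : USphere n → ℝ} (hw : Continuous w) {B R : ℝ}
    (hB : ∀ ξ, |w ξ| ≤ B) {g : Euc n → G} (hg : ContDiff ℝ 1 g)
    (hR : ∀ y, R < ‖y‖ → g y = 0) : fderiv ℝ (lineAvg w g) = lineAvg w (fderiv ℝ g) :=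
  funext fun x => (hasFDerivAt_lineAvg hw hB hg hR x).fderiv

theorem contDiff_nat_lineAvg {w : USphere n → ℝ} (hw : Continuous w) {B R : ℝ}
    (hB : ∀ ξ, |w ξ| ≤ B) (k : ℕ) : ∀ {G : Type} [NormedAddCommGroup G] [NormedSpace ℝ G]
    {g : Euc n → G}, ContDiff ℝ ∞ g → (∀ y, R < ‖y‖ → g y = 0) → ContDiff ℝ k (lineAvg w g) := by
  induction k with
  | zero =>
    intro G _ _ g hg hR
    refine contDiff_zero.2 (continuous_iff_continuousAt.2 fun x => ?_)
    exact (hasFDerivAt_lineAvg hw hB (hg.of_le (by simp)) hR x).continuousAt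
  | succ k ih =>
    intro G _ _ g hg hR
    have h1 : ContDiff ℝ 1 g := hg.of_le (by simp)
    push_cast
    rw [contDiff_succ_iff_fderiv, fderiv_lineAvg hw hB h1 hR]
    exact ⟨fun x => (hasFDerivAt_lineAvg hw hB h1 hR x).differentiableAt, by simp,
      ih (hg.fderiv_right (by simp)) (fderiv_eq_zero_of_lt hR)⟩

theorem contDiff_lineAvg {w : USphere n → ℝ} (hw : Continuous w) {B R : ℝ}
    (hB : ∀ ξ, |w ξ| ≤ B) {g : Euc n → ℝ} (hg : ContDiff ℝ ∞ g)
    (hR : ∀ y, R < ‖y‖ → g y = 0) : ContDiff ℝ ∞ (lineAvg w g) :=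
  contDiff_infty.2 fun k => contDiff_nat_lineAvg hw hB k hg hR

theorem norm_iteratedFDeriv_lineAvg_le {w : USphere n → ℝ} (hw : Continuous w) {B R r : ℝ}
    (hB : ∀ ξ, |w ξ| ≤ B) (k : ℕ) : ∀ {G : Type} [NormedAddCommGroup G] [NormedSpace ℝ G]
    {g : Euc n → G} {M : ℝ}, ContDiff ℝ ∞ g → (∀ y, R < ‖y‖ → g y = 0) →
    (∀ y, ‖iteratedFDeriv ℝ k g y‖ ≤ M) → ∀ {x : Euc n}, ‖x‖ ≤ r →
    ‖iteratedFDeriv ℝ k (lineAvg w g) x‖ ≤ (((sphereMeasure n).prod volume).real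
      (Set.univ ×ˢ Set.Icc (-(R + r)) (R + r)) * B) * M := by
  induction k with
  | zero =>
    intro G _ _ g M hg hR hM x hx
    rw [norm_iteratedFDeriv_zero]
    exact norm_lineAvg_le hB (fun y => by simpa using hM y) hR hx
  | succ k ih =>
    intro G _ _ g M hg hR hM x hx
    rw [← norm_iteratedFDeriv_fderiv, fderiv_lineAvg hw hB (hg.of_le (by simp)) hR]
    exact ih (hg.fderiv_right (by simp)) (fderiv_eq_zero_of_lt hR)
      (fun y => by rw [norm_iteratedFDeriv_fderiv]; exact hM y) hx

end lineAvg

/-! ### Compactly supported distributions -/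

/-- The space `𝓓'(ℝⁿ)` of complex-valued distributions. -/
abbrev Distr (n : ℕ) := 𝓓'((⊤ : Opens (Euc n)), ℂ)

/-- The space of real test functions on `ℝⁿ`. -/
abbrev Test (n : ℕ) := 𝓓((⊤ : Opens (Euc n)), ℝ)

theorem dsupport_add_subset (S T : Distr n) :
    dsupport (⇑(S + T)) ⊆ dsupport ⇑S ∪ dsupport ⇑T := by
  intro x hx
  by_contra h
  rw [Set.mem_union, not_or] at h
  obtain ⟨U, hU, hUo, hxU⟩ := (notMem_dsupport_iff x).1 h.1
  obtain ⟨V, hV, hVo, hxV⟩ := (notMem_dsupport_iff x).1 h.2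
  refine (notMem_dsupport_iff x).2 ⟨U ∩ V, fun u hu => ?_, hUo.inter hVo, hxU, hxV⟩ hx
  have h1 := hU u (hu.trans Set.inter_subset_left)
  have h2 := hV u (hu.trans Set.inter_subset_right)
  change S u + T u = 0
  rw [h1, h2, add_zero]

/-- The space `𝓔'(ℝⁿ)` of compactly supported distributions, as a subspace of `𝓓'(ℝⁿ)`. -/
def CompDistr (n : ℕ) : Submodule ℝ (Distr n) where
  carrier := {T | IsCompact (dsupport ⇑T)}
  zero_mem' := by
    have : dsupport (⇑(0 : Distr n)) = ∅ := by
      refine Set.eq_empty_of_forall_notMem fun x => (notMem_dsupport_iff x).2 ?_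
      exact ⟨Set.univ, fun u _ => rfl, isOpen_univ, trivial⟩
    simp only [Set.mem_ofPred_eq, this, isCompact_empty]
  add_mem' {S T} hS hT := (hS.union hT).of_isClosed_subset isClosed_dsupport
    (dsupport_add_subset S T)
  smul_mem' c T hT := by
    refine IsCompact.of_isClosed_subset hT isClosed_dsupport (dsupport_subset_dsupport ?_)
    intro s _ hs u hu
    change c • T u = 0
    rw [hs u hu, smul_zero]

/-- Partial derivatives of a compactly supported distribution are compactly supported. -/
noncomputable instance : LineDeriv (Euc n) (CompDistr n) (CompDistr n) where
  lineDerivOp v T := ⟨∂_{v} (T : Distr n),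
    T.2.of_isClosed_subset isClosed_dsupport (dsupport_lineDerivOp_subset v)⟩

theorem exists_cutoff {K : Set (Euc n)} (hK : IsCompact K) :
    ∃ χ : Test n, ∀ᶠ x in 𝓝ˢ K, χ x = 1 := by
  obtain ⟨f, h1, h0, -⟩ := exists_contMDiffMap_one_nhds_of_subset_interior
    (n := (⊤ : ℕ∞)) (modelWithCornersSelf ℝ (Euc n)) hK.isClosed
    (t := Metric.cthickening 1 K)
    ((Metric.self_subset_thickening one_pos K).trans
      (interior_maximal (Metric.thickening_subset_cthickening 1 K) Metric.isOpen_thickening))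
  have hc : HasCompactSupport f := .intro hK.cthickening h0
  exact ⟨⟨f, f.contMDiff.contDiff, hc, by simp⟩, h1⟩

/-- A smooth compactly supported function equal to `1` in a neighbourhood of the support of `T`. -/
noncomputable def cutoff (T : CompDistr n) : Test n := (exists_cutoff T.2).choose

theorem cutoff_eq_one (T : CompDistr n) :
    ∀ᶠ x in 𝓝ˢ (dsupport ⇑(T : Distr n)), cutoff T x = 1 := (exists_cutoff T.2).choose_spec

/-- The product of a test function and a smooth function. -/
noncomputable def mulSmooth (χ : Test n) (g : Euc n → ℝ) (hg : ContDiff ℝ ∞ g) : Test n where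
  toFun x := χ x * g x
  contDiff' := χ.contDiff.mul hg
  hasCompactSupport' := χ.hasCompactSupport.mul_right
  tsupport_subset' := by simp

/-- The pairing `⟨T, g⟩` of a compactly supported distribution with a smooth function:
`T` is applied to `χ g`, where `χ` is a test function equal to `1` near the support of `T`. -/
noncomputable def pair (T : CompDistr n) (g : Euc n → ℝ) (hg : ContDiff ℝ ∞ g) : ℂ :=
  (T : Distr n) (mulSmooth (cutoff T) g hg)

/-- A distribution vanishes on the complement of its support. -/
theorem isVanishingOn_compl_dsupport (T : Distr n) : IsVanishingOn ⇑T (dsupport ⇑T)ᶜ := by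
  intro u hu
  choose! U hUv hUo hxU using fun x (hx : x ∈ tsupport u) => (notMem_dsupport_iff x).1 (hu hx)
  obtain ⟨t, ht⟩ := u.hasCompactSupport.elim_nhds_subcover' (fun x _ => U x)
    (fun x hx => (hUo x hx).mem_nhds (hxU x hx))
  obtain ⟨ρ, hρ⟩ := SmoothPartitionOfUnity.exists_isSubordinate
    (modelWithCornersSelf ℝ (Euc n)) (isClosed_tsupport u) (fun x : t => U (x.1 : Euc n))
    (fun x => hUo _ x.1.2) (by simpa [Set.iUnion_subtype] using ht)
  have hu' : u = ∑ i, mulSmooth u (ρ i) (ρ i).contMDiff.contDiff := by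
    ext x
    have : (∑ i, mulSmooth u (ρ i) (ρ i).contMDiff.contDiff : Test n) x = ∑ i, u x * ρ i x := by
      simp [mulSmooth]
    rw [this, ← Finset.mul_sum]
    by_cases hx : x ∈ tsupport u
    · have h1 := ρ.sum_eq_one hx
      rw [finsum_eq_sum_of_fintype] at h1
      rw [h1, mul_one]
    · rw [image_eq_zero_of_notMem_tsupport hx, zero_mul]
  rw [hu', map_sum]
  refine Finset.sum_eq_zero fun i _ => hUv _ i.1.2 _ ?_
  exact (tsupport_mul_subset_right (f := u) (g := ρ i)).trans (hρ i)

/-- The pairing does not depend on the choice of the cutoff function. -/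
theorem pair_eq (T : CompDistr n) (g : Euc n → ℝ) (hg : ContDiff ℝ ∞ g) (χ : Test n)
    (hχ : ∀ᶠ x in 𝓝ˢ (dsupport ⇑(T : Distr n)), χ x = 1) :
    pair T g hg = (T : Distr n) (mulSmooth χ g hg) := by
  rw [pair, ← sub_eq_zero, ← map_sub]
  refine isVanishingOn_compl_dsupport _ _ fun x hx hxT => ?_
  have h := (Filter.Eventually.and hχ (cutoff_eq_one T)).filter_mono (nhds_le_nhdsSet hxT)
  refine (notMem_tsupport_iff_eventuallyEq.2 ?_) hx
  filter_upwards [h] with y hy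
  change cutoff T y * g y - χ y * g y = 0
  rw [hy.1, hy.2, sub_self]

/-! ### Ray transform and normal operator -/

/-- The manifold `TS^{n-1} = {(x, ξ) : |ξ| = 1, ⟨x, ξ⟩ = 0}` of oriented lines in `ℝⁿ`. -/
def LineSpace (n : ℕ) : Set (Euc n × Euc n) := {p | ‖p.2‖ = 1 ∧ inner ℝ p.1 p.2 = 0}

/-- The oriented line through `x` with direction `ξ`, that is `(x - ⟨x, ξ⟩ ξ, ξ)`. -/
noncomputable def lineThrough (x : Euc n) (ξ : USphere n) : LineSpace n :=
  ⟨(x - inner ℝ x (ξ : Euc n) • (ξ : Euc n), ξ), by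
    have hn : ‖(ξ : Euc n)‖ = 1 := by simp
    refine ⟨hn, ?_⟩
    simp only [inner_sub_left, inner_smul_left, real_inner_self_eq_norm_sq, hn]
    simp⟩

/-- The component `ξ_{i₁} ⋯ ξ_{i_m}` of the `m`-th tensor power of `ξ`. -/
noncomputable def monomial {m : ℕ} (ξ : Euc n) (I : Fin m → Fin n) : ℝ := ∏ k, ξ (I k)

/-- The ray transform
`(I_m φ)(x, ξ) = ∫ φ_{i₁ … i_m}(x + t ξ) ξ^{i₁} ⋯ ξ^{i_m} dt` of a test tensor field. -/
noncomputable def rayTransform {m : ℕ} (φ : TensorField n m (Euc n → ℝ)) (p : LineSpace n) : ℝ :=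
  ∫ t : ℝ, ∑ I : Fin m → Fin n, φ I (p.1.1 + t • p.1.2) * monomial p.1.2 I

/-- The formal adjoint of the ray transform,
`(I_m^* g)_{i₁ … i_m}(x) = ∫_{S^{n-1}} ξ_{i₁} ⋯ ξ_{i_m} g(x - ⟨x, ξ⟩ ξ, ξ) dS_ξ`. -/
noncomputable def rayAdjoint {m : ℕ} (g : LineSpace n → ℝ) : TensorField n m (Euc n → ℝ) :=
  fun I x => ∫ ξ : USphere n, monomial (ξ : Euc n) I * g (lineThrough x ξ) ∂(sphereMeasure n)

/-- The normal operator `I_m^* I_m` on test tensor fields. -/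
noncomputable def normalTest {m : ℕ} (φ : TensorField n m (Euc n → ℝ)) :
    TensorField n m (Euc n → ℝ) := rayAdjoint (rayTransform φ)

section normal

variable {m : ℕ}

theorem abs_monomial_le (ξ : USphere n) (I : Fin m → Fin n) : |monomial (ξ : Euc n) I| ≤ 1 := by
  rw [monomial, Finset.abs_prod]
  refine Finset.prod_le_one (fun _ _ => abs_nonneg _) fun k _ => ?_
  have h := PiLp.norm_apply_le (ξ : Euc n) (I k)
  have hn : ‖(ξ : Euc n)‖ = 1 := by simp
  rwa [hn, Real.norm_eq_abs] at h

theorem continuous_weight (J K : Fin m → Fin n) :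
    Continuous fun ξ : USphere n => monomial (ξ : Euc n) K * monomial (ξ : Euc n) J := by
  unfold monomial; fun_prop

theorem abs_weight_le (J K : Fin m → Fin n) (ξ : USphere n) :
    |monomial (ξ : Euc n) K * monomial (ξ : Euc n) J| ≤ 1 := by
  rw [abs_mul]
  exact mul_le_one₀ (abs_monomial_le ξ K) (abs_nonneg _) (abs_monomial_le ξ J)

theorem exists_radius (ψ : Test n) : ∃ R : ℝ, ∀ y, R < ‖y‖ → ψ y = 0 := by
  obtain ⟨R, hR⟩ := ψ.hasCompactSupport.isBounded.exists_norm_le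
  exact ⟨R, fun y hy => image_eq_zero_of_notMem_tsupport fun h => (hR y h).not_gt hy⟩

theorem normalTest_single (ψ : Test n) (J K : Fin m → Fin n) :
    normalTest (Pi.single J ⇑ψ) K =
      lineAvg (fun ξ => monomial (ξ : Euc n) K * monomial (ξ : Euc n) J) ψ := by
  funext x
  obtain ⟨R, hR⟩ := exists_radius ψ
  obtain ⟨M, hM⟩ := exists_norm_bound ψ.continuous hR
  rw [lineAvg, integral_prod _ (lineAvg_integrable (continuous_weight J K) (abs_weight_le J K)
    ψ.continuous hM hR x)]
  refine integral_congr_ae (.of_forall fun ξ => ?_)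
  have h1 (y : Euc n) : ∑ I : Fin m → Fin n, (Pi.single J ⇑ψ : TensorField n m (Euc n → ℝ)) I y *
      monomial (ξ : Euc n) I = ψ y * monomial (ξ : Euc n) J := by
    rw [Finset.sum_eq_single J]
    · simp
    · intro I _ hI
      simp [Pi.single_eq_of_ne hI]
    · simp
  have h2 : rayTransform (Pi.single J ⇑ψ) (lineThrough x ξ) =
      ∫ t : ℝ, ψ (x + t • (ξ : Euc n)) * monomial (ξ : Euc n) J := by
    simp only [rayTransform, lineThrough, h1]
    rw [← integral_add_right_eq_self (fun t : ℝ => ψ (x + t • (ξ : Euc n)) *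
      monomial (ξ : Euc n) J) (-inner ℝ x (ξ : Euc n))]
    refine integral_congr_ae (.of_forall fun t => ?_)
    simp only [add_smul, neg_smul]
    congr 2
    abel
  simp only [h2, smul_eq_mul, ← integral_const_mul]
  refine integral_congr_ae (.of_forall fun t => ?_)
  simp only
  ring

theorem contDiff_normalTest_single (ψ : Test n) (J K : Fin m → Fin n) :
    ContDiff ℝ ∞ (normalTest (Pi.single J ⇑ψ) K) := by
  obtain ⟨R, hR⟩ := exists_radius ψ
  rw [normalTest_single]
  exact contDiff_lineAvg (continuous_weight J K) (abs_weight_le J K) ψ.contDiff hR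

theorem lineAvg_add {w : USphere n → ℝ} (hw : Continuous w) {B : ℝ} (hB : ∀ ξ, |w ξ| ≤ B)
    (φ ψ : Test n) (x : Euc n) :
    lineAvg w ⇑(φ + ψ) x = lineAvg w φ x + lineAvg w ψ x := by
  obtain ⟨R, hR⟩ := exists_radius φ
  obtain ⟨M, hM⟩ := exists_norm_bound φ.continuous hR
  obtain ⟨R', hR'⟩ := exists_radius ψ
  obtain ⟨M', hM'⟩ := exists_norm_bound ψ.continuous hR'
  rw [lineAvg, lineAvg, lineAvg, ← integral_add (lineAvg_integrable hw hB φ.continuous hM hR x)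
    (lineAvg_integrable hw hB ψ.continuous hM' hR' x)]
  refine integral_congr_ae (.of_forall fun p => ?_)
  change _ * (φ _ + ψ _) = _ * φ _ + _ * ψ _
  ring

theorem lineAvg_smul (w : USphere n → ℝ) (c : ℝ) (φ : Test n) (x : Euc n) :
    lineAvg w ⇑(c • φ) x = c * lineAvg w φ x := by
  rw [lineAvg, lineAvg, ← integral_const_mul]
  refine integral_congr_ae (.of_forall fun p => ?_)
  change _ * (c * φ _) = c * (_ * φ _)
  ring

/-- `ψ ↦ χ · (weighted line average of ψ)`, on test functions supported in a compact set. -/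
noncomputable def cutoffAvgOn {w : USphere n → ℝ} (hw : Continuous w) (hB : ∀ ξ, |w ξ| ≤ 1)
    (χ : Test n) (K : Compacts (Euc n)) :
    𝓓_{K}(Euc n, ℝ) →L[ℝ] 𝓓_{⟨tsupport χ, χ.hasCompactSupport⟩}(Euc n, ℝ) :=
  ContDiffMapSupportedIn.mkCLM ℝ (fun φ x => χ x * lineAvg w φ x)
    (fun φ ψ x => by
      have hsub : (K : Set (Euc n)) ⊆ (⊤ : Opens (Euc n)) := by simp
      rw [← mul_add]
      congr 1
      exact lineAvg_add hw hB (TestFunction.ofSupportedIn hsub φ)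
        (TestFunction.ofSupportedIn hsub ψ) x)
    (fun c φ x => by
      have hsub : (K : Set (Euc n)) ⊆ (⊤ : Opens (Euc n)) := by simp
      have := lineAvg_smul w c (TestFunction.ofSupportedIn hsub φ) x
      change χ x * lineAvg w ⇑(c • TestFunction.ofSupportedIn hsub φ) x = _
      rw [this]
      change _ = c * (χ x * lineAvg w (TestFunction.ofSupportedIn hsub φ) x)
      ring)
    (fun φ => by
      have hsub : (K : Set (Euc n)) ⊆ (⊤ : Opens (Euc n)) := by simp
      obtain ⟨R, hR⟩ := exists_radius (TestFunction.ofSupportedIn hsub φ)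
      exact χ.contDiff.mul (contDiff_lineAvg hw hB φ.contDiff hR))
    (fun φ x hx => by
      change χ x * _ = 0
      rw [image_eq_zero_of_notMem_tsupport hx, zero_mul])
    (fun i _ => by
      obtain ⟨R, hR⟩ := K.isCompact.isBounded.exists_norm_le
      obtain ⟨r, hr⟩ := χ.hasCompactSupport.isBounded.exists_norm_le
      have hφ (φ : 𝓓_{K}(Euc n, ℝ)) (y : Euc n) (hy : R < ‖y‖) : φ y = 0 :=
        φ.zero_on_compl fun h => (hR y h).not_gt hy
      set D : ℝ := ((sphereMeasure n).prod volume).real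
        (Set.univ ×ˢ Set.Icc (-(R + r)) (R + r)) * 1 with hD
      have hD0 : 0 ≤ D := by positivity
      have hχ (j : ℕ) : ∃ C, ∀ x, ‖iteratedFDeriv ℝ j χ x‖ ≤ C :=
        (χ.hasCompactSupport.iteratedFDeriv j).exists_bound_of_continuous
          (χ.contDiff.continuous_iteratedFDeriv (by exact_mod_cast le_top))
      choose C hC using hχ
      have hC0 (j : ℕ) : 0 ≤ C j := (norm_nonneg _).trans (hC j 0)
      refine ⟨Finset.Iic i, ∑ j ∈ Finset.range (i + 1), (i.choose j : ℝ) * C j * D,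
        Finset.sum_nonneg fun j _ => by have := hC0 j; positivity, fun φ x hx => ?_⟩
      have hsm : ContDiff ℝ ∞ (lineAvg w φ) := contDiff_lineAvg hw hB φ.contDiff (hφ φ)
      refine (norm_iteratedFDeriv_mul_le (n := i) χ.contDiff hsm x
        (by exact_mod_cast le_top)).trans ?_
      rw [Finset.sum_mul]
      refine Finset.sum_le_sum fun j hj => ?_
      rw [mul_assoc (_ * C j)]
      refine mul_le_mul (mul_le_mul_of_nonneg_left (hC j x) (by positivity)) ?_
        (norm_nonneg _) (by have := hC0 j; positivity)
      refine norm_iteratedFDeriv_lineAvg_le hw hB (i - j) φ.contDiff (hφ φ) (fun y => ?_) (hr x hx)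
      exact (ContDiffMapSupportedIn.norm_iteratedFDeriv_apply_le_seminorm_top ℝ).trans
        (Seminorm.le_finset_sup_apply
          (p := fun j => ContDiffMapSupportedIn.seminorm ℝ (Euc n) ℝ ⊤ K j) (i := i - j)
          (Finset.mem_Iic.2 (Nat.sub_le i j))))

/-- For fixed `χ`, `J`, `K`, the continuous map `ψ ↦ χ · (N_m (ψ e_J))_K` on test functions, where
`ψ e_J` is the tensor field whose only nonzero component is `ψ`, in position `J`. -/
noncomputable def cutoffNormal (χ : Test n) (J K : Fin m → Fin n) : Test n →L[ℝ] Test n :=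
  TestFunction.limitCLM ℝ
    (fun ψ => mulSmooth χ (normalTest (Pi.single J ⇑ψ) K) (contDiff_normalTest_single ψ J K))
    (fun L _ => TestFunction.ofSupportedInCLM ℝ (by simp) ∘L
      cutoffAvgOn (continuous_weight J K) (abs_weight_le J K) χ L)
    (fun L hL ψ => by
      ext x
      change χ x * normalTest (Pi.single J ⇑(TestFunction.ofSupportedIn hL ψ)) K x = _
      rw [normalTest_single]
      rfl)

/-- The normal operator `N_m = I_m^* I_m : 𝓔'(ℝⁿ; T^m) → 𝓓'(ℝⁿ; T^m)`, the extension by duality of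
`normalTest`: for a test function `ψ`,
`⟨(N_m f)_J, ψ⟩ = ⟨I_m f, I_m (ψ e_J)⟩ = ∑_K ⟨f_K, (I_m^* I_m (ψ e_J))_K⟩`
(see `normalOp_apply`). -/
noncomputable def normalOp (f : TensorField n m (CompDistr n)) : TensorField n m (Distr n) :=
  fun J => ∑ K : Fin m → Fin n,
    (cutoffNormal (cutoff (f K)) J K).precompCompactConvergenceCLM ℂ (f K : Distr n)

theorem normalOp_apply (f : TensorField n m (CompDistr n)) (J : Fin m → Fin n) (ψ : Test n) :
    normalOp f J ψ = ∑ K : Fin m → Fin n,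
      pair (f K) (normalTest (Pi.single J ⇑ψ) K) (contDiff_normalTest_single ψ J K) := by
  simp only [normalOp, sum_apply]
  rfl

end normal

/-! ### Algebraic operators and the Saint-Venant operator -/

section algebra

variable {m : ℕ} {D : Type*} [AddCommGroup D] [Module ℝ D]

/-- A tensor field is symmetric if its components do not change under permutations of the
indices. -/
def IsSymm {D : Type*} (f : TensorField n m D) : Prop :=
  ∀ (π : Equiv.Perm (Fin m)) (I : Fin m → Fin n), f (fun k => I (π k)) = f I

/-- The symmetrization `σ(i₁ … i_m)`. -/
noncomputable def symmetrize (u : TensorField n m D) : TensorField n m D :=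
  fun I => (1 / (m.factorial : ℝ)) • ∑ π : Equiv.Perm (Fin m), u fun k => I (π k)

/-- The operator `i` of symmetric multiplication by the Euclidean metric,
`(i f)_{i₁ … i_{m+2}} = σ(i₁ … i_{m+2}) δ_{i₁ i₂} f_{i₃ … i_{m+2}}`. -/
noncomputable def mulMetric (f : TensorField n m D) : TensorField n (m + 2) D :=
  symmetrize fun I => if I 0 = I 1 then f fun k => I k.succ.succ else 0

/-- The dual operator `j`, contraction of the last two indices,
`(j g)_{i₁ … i_m} = ∑_p g_{i₁ … i_m p p}`. -/
def trace (g : TensorField n (m + 2) D) : TensorField n m D :=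
  fun I => ∑ p : Fin n, g (Fin.append I ![p, p])

/-- The power `i^l`. -/
noncomputable def mulMetricPow : (l : ℕ) → TensorField n m D → TensorField n (m + 2 * l) D
  | 0, f => f
  | l + 1, f => mulMetric (mulMetricPow l f)

/-- The power `j^l`. -/
def tracePow : (l : ℕ) → TensorField n (m + 2 * l) D → TensorField n m D
  | 0, g => g
  | l + 1, g => tracePow l (trace g)

/-- The operator `i^l j^l` on tensors of order `m ≥ 2l`. -/
noncomputable def metricTrace (l : ℕ) (h : 2 * l ≤ m) (g : TensorField n m D) :
    TensorField n m D :=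
  fun I => mulMetricPow l
    (tracePow l fun K : Fin (m - 2 * l + 2 * l) → Fin n =>
      g fun k => K (Fin.cast (Nat.sub_add_cancel h).symm k))
    fun k => I (Fin.cast (Nat.sub_add_cancel h) k)

/-- The alternation `α(i_p j_p)` of a tensor field `u_{i₁ j₁ … i_m j_m}`, which is written as a
function of the two multi-indices `(i₁, …, i_m)` and `(j₁, …, j_m)`. -/
noncomputable def alternate (p : Fin m) (u : (Fin m → Fin n) → (Fin m → Fin n) → D) :
    (Fin m → Fin n) → (Fin m → Fin n) → D :=
  fun I J => (1 / 2 : ℝ) •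
    (u I J - u (Function.update I p (J p)) (Function.update J p (I p)))

/-- The operator
`(R f)_{i₁ j₁ … i_m j_m} = α(i₁ j₁) ⋯ α(i_m j_m) ∂^m f_{i₁ … i_m} / ∂x_{j₁} ⋯ ∂x_{j_m}`. -/
noncomputable def saintVenant [LineDeriv (Euc n) D D] (f : TensorField n m D) :
    (Fin m → Fin n) → (Fin m → Fin n) → D :=
  (List.finRange m).foldr alternate fun I J =>
    ∂^{fun k => (EuclideanSpace.single (J k) 1 : Euc n)} (f I)

end algebra

/-- The scalar normal operator `N_0 : 𝓔'(ℝⁿ) → 𝓓'(ℝⁿ)`. -/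
noncomputable def scalarNormalOp (u : CompDistr n) : Distr n :=
  normalOp (m := 0) (fun _ => u) Fin.elim0

/-- The constant
`c_{l,m} = (∏_{p=0}^{m-l-1} (n - 1 + 2p)) (-1)^l m! / (2^l l! (m - 2l)!)`. -/
noncomputable def coeff (n l m : ℕ) : ℝ :=
  (∏ p ∈ Finset.range (m - l), ((n : ℝ) - 1 + 2 * p)) *
    ((-1) ^ l * m.factorial / (2 ^ l * l.factorial * (m - 2 * l).factorial))

end RayTensor

/-!
The operator `N_m` is the convolution with the tensor kernel `2 y_K y_I |y|^{1-n-2m}`, so that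
`∑_l c_{l,m} i^l j^l N_m f` has the kernel `2 y_K P_I(y) |y|^{1-n-2m}`, where
`P = ∑_l c_{l,m} i^l j^l y^m`. The constants `c_{l,m}` are the ones of the Gegenbauer polynomials:
a Rodrigues type formula says that `P_I(y) |y|^{1-n-2m} = (-1)^m ∂_I |y|^{1-n}`
(`iteratedFDeriv_normPow`; by polarization one only has to differentiate `m` times in a single
direction). Hence, up to sign, the right-hand side of the theorem is the alternation over all pairs
`(i_p, j_p)` of `∂_J (y_K ∂_I |y|^{1-n})`, convolved with `f_K`.

For a single pair, `∂_j y_K ∂_i - ∂_i y_K ∂_j = (∂_j y_K) ∂_i - (∂_i y_K) ∂_j`, since second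
derivatives commute. Applied to all pairs, this leaves only the terms in which `m` derivatives fall
on the monomial `y_K` of degree `m` (`alternateAll_leibniz`). These derivatives are constants, and
contracting them with the symmetric tensor `f` gives `m! f_I` (`sum_permCount_smul`). What remains
is `m! |y|^{1-n}` convolved with `R f`, that is, the left-hand side.

On distributions everything is transposed to test functions. The kernel identity then becomes an
identity between line averages, `lineAvg_traceSum`: the average of a test function `φ` over the
lines through `x` with the weight `ξ_K P_I(ξ)` is the unweighted average of `∂_I ((y - x)_K φ)`. It
follows from polar coordinates and integration by parts against `(|y|² + c)^{(1-n)/2}`, letting `c → 0`.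
-/

namespace RayTensor

/-! ### Alternation over all pairs of indices -/

section Alternation

variable {n m : ℕ} {D D' : Type*} [AddCommGroup D] [Module ℝ D] [AddCommGroup D'] [Module ℝ D']

/-- The product `α(i₁ j₁) ⋯ α(i_m j_m)` of the alternations over all pairs. -/
noncomputable def alternateAll (u : (Fin m → Fin n) → (Fin m → Fin n) → D) :
    (Fin m → Fin n) → (Fin m → Fin n) → D :=
  (List.finRange m).foldr alternate u

theorem foldr_alternate_map_succ (L : List (Fin m))
    (u : (Fin (m + 1) → Fin n) → (Fin (m + 1) → Fin n) → D) (i j : Fin n) (I J : Fin m → Fin n) :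
    (L.map Fin.succ).foldr alternate u (Fin.cons i I) (Fin.cons j J) =
      L.foldr alternate (fun I J => u (Fin.cons i I) (Fin.cons j J)) I J := by
  induction L generalizing I J with
  | nil => rfl
  | cons p L ih => simp only [List.map_cons, List.foldr_cons, alternate, Fin.cons_succ,
      ← Fin.cons_update, ih]

theorem alternateAll_cons (u : (Fin (m + 1) → Fin n) → (Fin (m + 1) → Fin n) → D) (i j : Fin n)
    (I J : Fin m → Fin n) :
    alternateAll u (Fin.cons i I) (Fin.cons j J) =
      (1 / 2 : ℝ) • (alternateAll (fun I J => u (Fin.cons i I) (Fin.cons j J)) I J -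
        alternateAll (fun I J => u (Fin.cons j I) (Fin.cons i J)) I J) := by
  simp only [alternateAll, List.finRange_succ, List.foldr_cons, alternate, Fin.cons_zero,
    Fin.update_cons_zero, foldr_alternate_map_succ]

theorem alternateAll_zero (u : (Fin 0 → Fin n) → (Fin 0 → Fin n) → D) (I J : Fin 0 → Fin n) :
    alternateAll u I J = u I J := rfl

theorem map_alternateAll (L : D →ₗ[ℝ] D') (u : (Fin m → Fin n) → (Fin m → Fin n) → D)
    (I J : Fin m → Fin n) :
    L (alternateAll u I J) = alternateAll (fun I J => L (u I J)) I J := by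
  have (l : List (Fin m)) (I J : Fin m → Fin n) :
      L (l.foldr alternate u I J) = l.foldr alternate (fun I J => L (u I J)) I J := by
    induction l generalizing I J with
    | nil => rfl
    | cons p l ih => simp only [List.foldr_cons, alternate, map_smul, map_sub, ih]
  exact this _ I J

theorem alternateAll_add (u v : (Fin m → Fin n) → (Fin m → Fin n) → D) (I J : Fin m → Fin n) :
    alternateAll (fun I J => u I J + v I J) I J = alternateAll u I J + alternateAll v I J := by
  have h := map_alternateAll (LinearMap.fst ℝ D D + LinearMap.snd ℝ D D)
    (fun I J => (u I J, v I J)) I J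
  have h1 := map_alternateAll (LinearMap.fst ℝ D D) (fun I J => (u I J, v I J)) I J
  have h2 := map_alternateAll (LinearMap.snd ℝ D D) (fun I J => (u I J, v I J)) I J
  simp only [LinearMap.add_apply, h1, h2, LinearMap.fst_apply, LinearMap.snd_apply] at h
  exact h.symm

theorem alternateAll_smul (c : ℝ) (u : (Fin m → Fin n) → (Fin m → Fin n) → D)
    (I J : Fin m → Fin n) :
    alternateAll (fun I J => c • u I J) I J = c • alternateAll u I J :=
  (map_alternateAll (LinearMap.lsmul ℝ D c) u I J).symm

theorem alternateAll_sum {ι : Type*} [Fintype ι] (u : ι → (Fin m → Fin n) → (Fin m → Fin n) → D)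
    (I J : Fin m → Fin n) :
    alternateAll (fun I J => ∑ l, u l I J) I J = ∑ l, alternateAll (u l) I J := by
  have h := map_alternateAll (∑ l, LinearMap.proj l : (ι → D) →ₗ[ℝ] D) (fun I J l => u l I J) I J
  have h1 (l : ι) : alternateAll (fun I J l => u l I J) I J l = alternateAll (u l) I J :=
    map_alternateAll (LinearMap.proj l : (ι → D) →ₗ[ℝ] D) (fun I J l => u l I J) I J
  simp only [LinearMap.sum_apply, LinearMap.proj_apply, h1] at h
  exact h.symm

/-- The iterated operator `d_{i₁} ⋯ d_{i_m}`. -/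
def iterOp {E : Type*} (d : Fin n → E → E) (I : Fin m → Fin n) (e : E) : E :=
  (List.ofFn I).foldr d e

theorem iterOp_cons {E : Type*} (d : Fin n → E → E) (i : Fin n) (I : Fin m → Fin n) (e : E) :
    iterOp d (Fin.cons i I : Fin (m + 1) → Fin n) e = d i (iterOp d I e) := by
  simp [iterOp, List.ofFn_succ]

theorem iterOp_zero {E : Type*} (d : Fin n → E → E) (I : Fin 0 → Fin n) (e : E) :
    iterOp d I e = e := by
  simp [iterOp]

theorem iterOp_comm {E : Type*} (d : Fin n → E → E) (hd : ∀ i j e, d i (d j e) = d j (d i e))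
    (I : Fin m → Fin n) (i : Fin n) (e : E) : iterOp d I (d i e) = d i (iterOp d I e) := by
  unfold iterOp
  induction List.ofFn I with
  | nil => rfl
  | cons p l ih => rw [List.foldr_cons, ih, hd, List.foldr_cons]

/-- In the alternation of `∂_I (p ∂_J e)` all derivatives `∂_I` may be moved onto the factor `p`:
for a single pair, `∂_i p ∂_j - ∂_j p ∂_i = (∂_i p) ∂_j - (∂_j p) ∂_i`. -/
theorem alternateAll_leibniz {P E : Type*} [AddCommGroup E] [Module ℝ E]
    (dP : Fin n → P → P) (dE : Fin n → E →ₗ[ℝ] E)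
    (hd : ∀ i j e, dE i (dE j e) = dE j (dE i e)) (b : P → E → E)
    (hb : ∀ i p e, dE i (b p e) = b (dP i p) e + b p (dE i e)) (p : P) (e : E) (I J : Fin m → Fin n) :
    alternateAll (fun I J => iterOp (fun i => dE i) I (b p (iterOp (fun i => dE i) J e))) I J =
      alternateAll (fun I J => b (iterOp dP I p) (iterOp (fun i => dE i) J e)) I J := by
  induction m generalizing p e with
  | zero => simp only [alternateAll_zero, iterOp_zero]
  | succ m ih =>
    have key (i j : Fin n) (I J : Fin m → Fin n) :
        alternateAll (fun I J => iterOp (fun i => dE i) (Fin.cons i I : Fin (m + 1) → Fin n)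
          (b p (iterOp (fun i => dE i) (Fin.cons j J : Fin (m + 1) → Fin n) e))) I J =
        alternateAll (fun I J => b (iterOp dP (Fin.cons i I : Fin (m + 1) → Fin n) p)
          (iterOp (fun i => dE i) (Fin.cons j J : Fin (m + 1) → Fin n) e)) I J +
        alternateAll (fun I J => b (iterOp dP I p)
          (iterOp (fun i => dE i) J (dE i (dE j e)))) I J := by
      simp only [iterOp_cons]
      rw [← map_alternateAll (dE i)]
      have h := ih p (dE j e) I J
      simp only [iterOp_comm _ hd] at h
      rw [h, map_alternateAll]
      simp only [hb, iterOp_comm _ hd, alternateAll_add]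
    cases I using Fin.consCases with | _ i I =>
    cases J using Fin.consCases with | _ j J =>
    rw [alternateAll_cons, alternateAll_cons, key, key]
    simp only [hd j i e]
    congr 1
    abel

end Alternation

/-! ### Derivatives of monomials -/

section Monomials

variable {n m : ℕ}

/-- The number of permutations `π` with `K ∘ π = I`, by expansion along the first index. It is
the constant `∂_I y_K`. -/
def permCount {n : ℕ} : {m : ℕ} → (Fin m → Fin n) → (Fin m → Fin n) → ℕ
  | 0, _, _ => 1
  | _ + 1, I, K => ∑ k, if K k = I 0 then permCount (Fin.tail I) (k.removeNth K) else 0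

open MvPolynomial

theorem pderiv_pderiv_comm (i j : Fin n) (p : MvPolynomial (Fin n) ℝ) :
    pderiv i (pderiv j p) = pderiv j (pderiv i p) := by
  have h : ⁅pderiv (R := ℝ) i, pderiv (R := ℝ) j⁆ =
      (0 : Derivation ℝ (MvPolynomial (Fin n) ℝ) (MvPolynomial (Fin n) ℝ)) := by
    apply MvPolynomial.derivation_ext
    intro k
    simp [Derivation.commutator_apply, pderiv_X, Pi.single_apply, apply_ite]
  have := congrArg (fun D => D p) h
  simpa [Derivation.commutator_apply, sub_eq_zero] using this

theorem pderiv_prod {ι : Type*} [DecidableEq ι] (i : Fin n) (s : Finset ι)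
    (p : ι → MvPolynomial (Fin n) ℝ) :
    pderiv i (∏ k ∈ s, p k) = ∑ k ∈ s, (∏ k' ∈ s.erase k, p k') * pderiv i (p k) := by
  induction s using Finset.induction_on with
  | empty => simp
  | insert a s ha ih =>
    rw [Finset.prod_insert ha, pderiv_mul, ih, Finset.sum_insert ha, Finset.erase_insert ha,
      mul_comm, Finset.mul_sum]
    congr 1
    refine Finset.sum_congr rfl fun k hk => ?_
    have hak : a ≠ k := fun h => ha (h ▸ hk)
    rw [Finset.erase_insert_of_ne hak, Finset.prod_insert (fun h => ha (Finset.mem_of_mem_erase h)),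
      mul_assoc]

theorem pderiv_prod_X (i : Fin n) (K : Fin (m + 1) → Fin n) :
    pderiv i (∏ k, X (K k) : MvPolynomial (Fin n) ℝ) =
      ∑ k, if K k = i then ∏ k', X (k.removeNth K k') else 0 := by
  rw [pderiv_prod]
  refine Finset.sum_congr rfl fun k _ => ?_
  have h : ∏ k' ∈ Finset.univ.erase k, (X (K k') : MvPolynomial (Fin n) ℝ) =
      ∏ k', X (k.removeNth K k') := by
    rw [Fin.univ_succAbove m k, Finset.erase_cons, Finset.prod_map]
    rfl
  rw [h, pderiv_X, Pi.single_apply]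
  by_cases hk : K k = i
  · simp [hk]
  · simp [hk]

theorem iterOp_pderiv_sum {ι : Type*} (s : Finset ι) (p : ι → MvPolynomial (Fin n) ℝ)
    (I : Fin m → Fin n) :
    iterOp (fun i => pderiv (R := ℝ) i) I (∑ k ∈ s, p k) =
      ∑ k ∈ s, iterOp (fun i => pderiv (R := ℝ) i) I (p k) := by
  unfold iterOp
  induction List.ofFn I with
  | nil => rfl
  | cons i l ih => simp only [List.foldr_cons, ih, map_sum]

theorem iterOp_pderiv_prod_X (I K : Fin m → Fin n) :
    iterOp (fun i => pderiv (R := ℝ) i) I (∏ k, X (K k)) = C (permCount I K : ℝ) := by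
  induction m with
  | zero => simp [iterOp_zero, permCount]
  | succ m ih =>
    cases I using Fin.consCases with | _ i I =>
    have h0 : iterOp (fun i => pderiv (R := ℝ) i) I (0 : MvPolynomial (Fin n) ℝ) = 0 := by
      simpa using iterOp_pderiv_sum (∅ : Finset ℕ) (fun _ => 0) I
    rw [iterOp_cons, ← iterOp_comm (fun i => pderiv (R := ℝ) i) pderiv_pderiv_comm, pderiv_prod_X,
      iterOp_pderiv_sum]
    simp only [permCount, Nat.cast_sum, map_sum, Fin.cons_zero, Fin.tail_cons]
    refine Finset.sum_congr rfl fun k _ => ?_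
    split_ifs
    · exact ih _ _
    · simpa using h0

/-- Contracting a symmetric tensor with the constants `∂_I y_K` multiplies it by `m!`. -/
theorem sum_permCount_smul {D : Type*} [AddCommGroup D] (f : TensorField n m D) (hf : IsSymm f)
    (I : Fin m → Fin n) : ∑ K, permCount I K • f K = m.factorial • f I := by
  induction m with
  | zero => simp [permCount, Unique.eq_default I]
  | succ m ih =>
    cases I using Fin.consCases with | _ i I =>
    have h1 (k : Fin (m + 1)) (K : Fin m → Fin n) :
        f (k.insertNth i K) = f (Fin.cons i K) := by
      rw [← hf k.cycleRange (Fin.cons i K)]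
      congr 1
      exact (Fin.cons_comp_cycleRange i K k).symm
    have hg : IsSymm (fun K : Fin m → Fin n => f (Fin.cons i K)) := by
      intro π K
      change f (Fin.cons i (K ∘ π)) = f (Fin.cons i K)
      rw [← hf (Equiv.Perm.decomposeFin.symm (0, π)) (Fin.cons i K)]
      congr 1
      funext k
      cases k using Fin.cases <;> simp
    have h2 := ih (fun K => f (Fin.cons i K)) hg I
    have h3 (k : Fin (m + 1)) : ∑ K : Fin (m + 1) → Fin n,
        (if K k = i then permCount I (k.removeNth K) else 0) • f K =
          ∑ K, permCount I K • f (Fin.cons i K) := by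
      rw [← (Fin.insertNthEquiv (fun _ => Fin n) k).sum_comp, Fintype.sum_prod_type_right]
      refine Finset.sum_congr rfl fun K _ => ?_
      simp only [Fin.insertNthEquiv, Equiv.coe_fn_mk, Fin.insertNth_apply_same,
        Fin.removeNth_insertNth]
      simp only [ite_smul, zero_smul, Finset.sum_ite_eq', Finset.mem_univ, if_true]
      exact congrArg (fun d => permCount I K • d) (h1 k K)
    simp only [permCount, Finset.sum_smul, Fin.cons_zero, Fin.tail_cons]
    rw [Finset.sum_comm]
    simp only [h3, h2]
    rw [Finset.sum_const, Nat.factorial_succ, mul_smul]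
    simp

end Monomials

/-! ### The operators `i` and `j` on symmetric tensors -/

section Metric

variable {n m : ℕ} {D D' : Type*} [AddCommGroup D] [Module ℝ D] [AddCommGroup D'] [Module ℝ D']

/-- The contraction `∑_I a_{i₁} ⋯ a_{i_m} u_{i₁ … i_m}`, that is, the homogeneous polynomial in `a`
associated with the tensor `u`. -/
noncomputable def contract (u : TensorField n m ℝ) (a : Euc n) : ℝ := ∑ I, monomial a I * u I

theorem monomial_comp_perm (a : Euc n) (π : Equiv.Perm (Fin m)) (I : Fin m → Fin n) :
    monomial a (fun k => I (π k)) = monomial a I :=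
  Equiv.prod_comp π fun k => a (I k)

theorem monomial_smul (c : ℝ) (a : Euc n) (I : Fin m → Fin n) :
    monomial (c • a) I = c ^ m * monomial a I := by
  simp [monomial, Finset.prod_mul_distrib]

theorem isSymm_symmetrize (u : TensorField n m D) : IsSymm (symmetrize u) := by
  intro π I
  simp only [symmetrize]
  congr 1
  exact Equiv.sum_comp (Equiv.mulLeft π) fun ρ => u fun k => I (ρ k)

theorem contract_symmetrize (u : TensorField n m ℝ) (a : Euc n) :
    contract (symmetrize u) a = contract u a := by
  have h (π : Equiv.Perm (Fin m)) :
      ∑ I : Fin m → Fin n, monomial a I * u (fun k => I (π k)) = contract u a := by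
    refine Eq.trans (Finset.sum_congr rfl fun I _ => ?_)
      ((Equiv.arrowCongr π.symm (Equiv.refl (Fin n))).sum_comp fun I => monomial a I * u I)
    change _ = monomial a (fun k => I (π k)) * u (fun k => I (π k))
    rw [monomial_comp_perm]
  simp only [contract, symmetrize, smul_eq_mul]
  simp only [← mul_assoc, mul_comm _ (1 / (m.factorial : ℝ))]
  simp only [mul_assoc, Finset.mul_sum]
  rw [Finset.sum_comm]
  simp only [← Finset.mul_sum, h]
  rw [Finset.sum_const, Finset.card_univ, Fintype.card_perm, Fintype.card_fin, nsmul_eq_mul,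
    ← mul_assoc, one_div, inv_mul_cancel₀ (by positivity), one_mul]
  rfl

theorem sum_coord_mul_self (a : Euc n) : ∑ p, a p * a p = ‖a‖ ^ 2 := by
  rw [EuclideanSpace.real_norm_sq_eq]
  simp only [sq]

theorem contract_mulMetric (u : TensorField n m ℝ) (a : Euc n) :
    contract (mulMetric u) a = ‖a‖ ^ 2 * contract u a := by
  rw [mulMetric, contract_symmetrize, contract, ← (Fin.consEquiv fun _ => Fin n).sum_comp,
    Fintype.sum_prod_type]
  have h (p : Fin n) : ∑ K : Fin (m + 1) → Fin n, monomial a (Fin.cons p K : Fin (m + 2) → Fin n) *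
      (if p = K 0 then u (fun k => K k.succ) else 0) = a p * a p * contract u a := by
    rw [← (Fin.consEquiv fun _ => Fin n).sum_comp, Fintype.sum_prod_type_right, contract,
      Finset.mul_sum]
    refine Finset.sum_congr rfl fun I _ => ?_
    simp [Fin.consEquiv, monomial, Fin.prod_univ_succ, mul_assoc]
  rw [← sum_coord_mul_self, Finset.sum_mul]
  exact Finset.sum_congr rfl fun p _ => h p

theorem contract_mulMetricPow (l : ℕ) (u : TensorField n m ℝ) (a : Euc n) :
    contract (mulMetricPow l u) a = (‖a‖ ^ 2) ^ l * contract u a := by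
  induction l with
  | zero => simp [mulMetricPow]
  | succ l ih =>
    change contract (mulMetric (mulMetricPow l u)) a = _
    rw [contract_mulMetric, ih, pow_succ' _ l, mul_assoc]

theorem isSymm_mulMetricPow (l : ℕ) (u : TensorField n m D) (hu : IsSymm u) :
    IsSymm (mulMetricPow l u) := by
  cases l with
  | zero => exact hu
  | succ l =>
    exact isSymm_symmetrize (D := D) fun I => if I 0 = I 1 then
      mulMetricPow l u fun k => I k.succ.succ else 0

theorem tracePow_monomial (l : ℕ) (c : ℝ) (a : Euc n) :
    tracePow l (fun I : Fin (m + 2 * l) → Fin n => c * monomial a I) =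
      fun I => c * (‖a‖ ^ 2) ^ l * monomial a I := by
  induction l generalizing c with
  | zero => simp [tracePow]
  | succ l ih =>
    have h : trace (fun I : Fin (m + 2 * l + 2) → Fin n => c * monomial a I) =
        fun I => c * ‖a‖ ^ 2 * monomial a I := by
      funext I
      simp only [trace, ← Finset.mul_sum, monomial, Fin.prod_univ_add, Fin.append_left,
        Fin.append_right, Fin.prod_univ_two, Matrix.cons_val_zero, Matrix.cons_val_one,
        sum_coord_mul_self]
      ring
    change tracePow l (trace (fun I : Fin (m + 2 * l + 2) → Fin n => c * monomial a I)) = _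
    rw [h, ih]
    funext I
    ring

/-- `i^l j^l` on tensors of order `m = k + 2 l`, without the subtraction in the order. -/
theorem metricTrace_eq {k l : ℕ} (h : 2 * l ≤ k + 2 * l) (g : TensorField n (k + 2 * l) D) :
    metricTrace l h g = mulMetricPow l (tracePow l g) := by
  have (k' : ℕ) (hk : k' + 2 * l = k + 2 * l) :
      (fun I : Fin (k + 2 * l) → Fin n => mulMetricPow l
        (tracePow l fun K : Fin (k' + 2 * l) → Fin n => g fun i => K (Fin.cast hk.symm i))
        fun i => I (Fin.cast hk i)) = mulMetricPow l (tracePow l g) := by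
    obtain rfl : k' = k := by omega
    rfl
  exact this _ _

theorem contract_metricTrace_monomial {l : ℕ} (h : 2 * l ≤ m) (y a : Euc n) :
    contract (metricTrace l h (monomial y)) a =
      (‖a‖ ^ 2) ^ l * (‖y‖ ^ 2) ^ l * inner ℝ a y ^ (m - 2 * l) := by
  obtain ⟨k, rfl⟩ : ∃ k, m = k + 2 * l := ⟨m - 2 * l, by omega⟩
  have h1 := tracePow_monomial (m := k) l 1 y
  simp only [one_mul] at h1
  have h2 : contract (m := k) (monomial y) a = inner ℝ a y ^ k := by
    simp only [contract, monomial, ← Finset.prod_mul_distrib]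
    rw [← Fintype.sum_pow (fun i => a i * y i) k]
    simp [PiLp.inner_apply, mul_comm]
  have h3 : contract (m := k) (fun I => (‖y‖ ^ 2) ^ l * monomial y I) a =
      (‖y‖ ^ 2) ^ l * contract (m := k) (monomial y) a := by
    simp only [contract, Finset.mul_sum]
    exact Finset.sum_congr rfl fun I _ => by ring
  rw [metricTrace_eq, contract_mulMetricPow, h1, h3, h2, Nat.add_sub_cancel]
  ring

theorem isSymm_metricTrace_monomial {l : ℕ} (h : 2 * l ≤ m) (y : Euc n) :
    IsSymm (metricTrace l h (monomial y)) := by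
  obtain ⟨k, rfl⟩ : ∃ k, m = k + 2 * l := ⟨m - 2 * l, by omega⟩
  have h1 := tracePow_monomial (m := k) l 1 y
  simp only [one_mul] at h1
  rw [metricTrace_eq, h1]
  refine isSymm_mulMetricPow l _ fun π I => ?_
  simp only [monomial_comp_perm]

theorem map_mulMetricPow (L : D →ₗ[ℝ] D') (l : ℕ) (u : TensorField n m D) (I) :
    L (mulMetricPow l u I) = mulMetricPow l (fun K => L (u K)) I := by
  induction l with
  | zero => rfl
  | succ l ih =>
    change L (mulMetric (mulMetricPow l u) I) = mulMetric (mulMetricPow l fun K => L (u K)) I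
    simp only [mulMetric, symmetrize, map_smul, map_sum, apply_ite L, map_zero, ih]

theorem map_tracePow (L : D →ₗ[ℝ] D') (l : ℕ) (u : TensorField n (m + 2 * l) D) (I) :
    L (tracePow l u I) = tracePow l (fun K => L (u K)) I := by
  induction l with
  | zero => rfl
  | succ l ih =>
    change L (tracePow l (trace u) I) = tracePow l (trace fun K => L (u K)) I
    rw [ih]
    congr 1
    funext K
    simp only [trace, map_sum]

theorem map_metricTrace (L : D →ₗ[ℝ] D') {l : ℕ} (h : 2 * l ≤ m) (u : TensorField n m D)
    (I : Fin m → Fin n) : L (metricTrace l h u I) = metricTrace l h (fun K => L (u K)) I := by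
  simp only [metricTrace, map_mulMetricPow, map_tracePow]

theorem metricTrace_smul (c : ℝ) {l : ℕ} (h : 2 * l ≤ m) (u : TensorField n m D)
    (I : Fin m → Fin n) : metricTrace l h (fun K => c • u K) I = c • metricTrace l h u I :=
  (map_metricTrace (LinearMap.lsmul ℝ D c) h u I).symm

/-- Polarization: a symmetric tensor is determined by its homogeneous polynomial. -/
theorem IsSymm.eq_of_contract_eq {u v : TensorField n m ℝ} (hu : IsSymm u) (hv : IsSymm v)
    (h : ∀ a, contract u a = contract v a) : u = v := by
  classical
  open MvPolynomial in
  let p (u : TensorField n m ℝ) : MvPolynomial (Fin n) ℝ := ∑ I, C (u I) * ∏ k, X (I k)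
  have hp : p u = p v := by
    refine MvPolynomial.funext fun a => ?_
    have h1 (u : TensorField n m ℝ) : MvPolynomial.eval a (p u) = contract u (WithLp.toLp 2 a) := by
      simp [p, contract, monomial, mul_comm, map_sum, map_prod]
    rw [h1, h1, h]
  funext I
  -- the exponent of the monomial `y_I`
  let e (I : Fin m → Fin n) : Fin n →₀ ℕ := ∑ k, Finsupp.single (I k) 1
  have he (K : Fin m → Fin n) (hK : e K = e I) :
      ∃ π : Equiv.Perm (Fin m), (fun k => I (π k)) = K := by
    have hcard (i : Fin n) : Fintype.card {k // K k = i} = Fintype.card {k // I k = i} := by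
      have := congrArg (fun f => f i) hK
      simpa [e, Finsupp.single_apply, Fintype.card_subtype] using this
    exact ⟨Equiv.ofFiberEquiv fun i => Fintype.equivOfCardEq (hcard i),
      funext fun k => Equiv.ofFiberEquiv_map _ k⟩
  have hc (u : TensorField n m ℝ) (hu : IsSymm u) : MvPolynomial.coeff (e I) (p u) =
      (Finset.univ.filter fun K => e K = e I).card • u I := by
    have hX (K : Fin m → Fin n) : (MvPolynomial.C (u K) * ∏ k, MvPolynomial.X (K k)) =
        MvPolynomial.monomial (e K) (u K) := by
      simp only [MvPolynomial.X, e, ← MvPolynomial.monomial_sum_one, MvPolynomial.C_mul_monomial,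
        mul_one]
    simp only [p, MvPolynomial.coeff_sum, hX, MvPolynomial.coeff_monomial]
    rw [← Finset.sum_filter, ← Finset.sum_const]
    refine Finset.sum_congr rfl fun K hK => ?_
    obtain ⟨π, rfl⟩ := he K (Finset.mem_filter.1 hK).2
    exact hu π I
  have h0 : (Finset.univ.filter fun K => e K = e I).card ≠ 0 :=
    (Finset.card_pos.2 ⟨I, by simp⟩).ne'
  have := hc u hu
  rw [hp, hc v hv] at this
  exact (smul_right_injective ℝ h0 this).symm

end Metric

/-! ### Iterated derivatives of powers of `|y|² + c` -/

section Kernel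

/-- The numbers `m! 2^{m-2l} / (l! (m-2l)!)`, by the recursion that they satisfy as coefficients in
the `m`-th derivative of a function of a quadratic polynomial. -/
def derivCoeff : ℕ → ℕ → ℕ
  | 0, 0 => 1
  | 0, _ + 1 => 0
  | m + 1, 0 => 2 * derivCoeff m 0
  | m + 1, l + 1 => (m - 2 * l) * derivCoeff m l + 2 * derivCoeff m (l + 1)

theorem derivCoeff_eq_zero {m l : ℕ} (h : m < 2 * l) : derivCoeff m l = 0 := by
  induction m generalizing l with
  | zero => cases l with
    | zero => omega
    | succ l => rfl
  | succ m ih => cases l with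
    | zero => omega
    | succ l =>
      rw [derivCoeff, ih (by omega : m < 2 * (l + 1)), Nat.mul_zero, Nat.add_zero]
      rcases Nat.lt_or_ge m (2 * l) with h1 | h1
      · rw [ih h1, Nat.mul_zero]
      · rw [show m - 2 * l = 0 by omega, Nat.zero_mul]

/-- The closed form of `derivCoeff m l` for `m = k + 2 l`, free of divisions. -/
theorem derivCoeff_mul (l k : ℕ) :
    derivCoeff (k + 2 * l) l * (l.factorial * k.factorial) = (k + 2 * l).factorial * 2 ^ k := by
  -- induction on the order `k + 2 * l`
  generalize hm : k + 2 * l = m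
  induction m generalizing l k with
  | zero =>
    obtain ⟨rfl, rfl⟩ : k = 0 ∧ l = 0 := by omega
    rfl
  | succ m ih =>
    cases l with
    | zero =>
      obtain rfl : k = m + 1 := by omega
      have h := ih 0 m rfl
      rw [derivCoeff, Nat.factorial_succ, pow_succ]
      simp only [Nat.factorial_zero, one_mul] at h ⊢
      calc _ = (m + 1) * 2 * (derivCoeff m 0 * m.factorial) := by ring
        _ = _ := by rw [h]; ring
    | succ l =>
      have h1 := ih l (k + 1) (by omega)
      rw [derivCoeff, show m - 2 * l = k + 1 by omega, Nat.factorial_succ m]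
      rw [Nat.factorial_succ k] at h1
      have h2 : 2 * derivCoeff m (l + 1) * ((l + 1).factorial * k.factorial) =
          k * (m.factorial * 2 ^ k) := by
        cases k with
        | zero => rw [derivCoeff_eq_zero (by omega)]; simp
        | succ k =>
          have h := ih (l + 1) k (by omega)
          rw [Nat.factorial_succ k]
          calc _ = 2 * (k + 1) * (derivCoeff m (l + 1) * ((l + 1).factorial * k.factorial)) := by
                ring
            _ = _ := by rw [h]; ring
      rw [add_mul, h2, Nat.factorial_succ l]
      calc _ = (l + 1) * (derivCoeff m l * (l.factorial * ((k + 1) * k.factorial))) +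
            k * (m.factorial * 2 ^ k) := by ring
        _ = (2 * (l + 1) + k) * (m.factorial * 2 ^ k) := by rw [h1]; ring
        _ = _ := by rw [show 2 * (l + 1) + k = m + 1 by omega]; ring

variable {n : ℕ}

/-- The function `(|y|² + c)^s`, which is smooth for `c > 0`. -/
noncomputable def normPow (c s : ℝ) (y : Euc n) : ℝ := (‖y‖ ^ 2 + c) ^ s

theorem contDiff_normPow {c : ℝ} (hc : 0 < c) (s : ℝ) {k : WithTop ℕ∞} :
    ContDiff ℝ k (normPow c s : Euc n → ℝ) :=
  ((contDiff_norm_sq ℝ).add contDiff_const).rpow_const_of_ne fun y => by positivity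

theorem hasDerivAt_line_normPow {c : ℝ} (hc : 0 < c) (s : ℝ) (y a : Euc n) :
    HasDerivAt (fun t : ℝ => normPow c s (y + t • a))
      (2 * s * inner ℝ a y * normPow c (s - 1) y) 0 := by
  have h1 : HasDerivAt (fun t : ℝ => ‖y + t • a‖ ^ 2 + c) (2 * inner ℝ a y) 0 := by
    have h0 : HasDerivAt (fun t : ℝ => y + t • a) a 0 := by
      simpa using ((hasDerivAt_id (0 : ℝ)).smul_const a).const_add y
    simpa [real_inner_comm] using h0.norm_sq.add_const c
  have h2 := h1.rpow_const (p := s) (.inl (by simp; positivity))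
  simp only [normPow]
  convert h2 using 1
  rw [zero_smul, add_zero]
  ring

theorem hasDerivAt_line_inner (y a : Euc n) :
    HasDerivAt (fun t : ℝ => inner ℝ a (y + t • a)) (‖a‖ ^ 2) 0 := by
  have h : HasDerivAt (fun t : ℝ => inner ℝ a y + t * ‖a‖ ^ 2) (‖a‖ ^ 2) 0 := by
    simpa using ((hasDerivAt_id (0 : ℝ)).mul_const (‖a‖ ^ 2)).const_add (inner ℝ a y)
  simpa [inner_add_right, inner_smul_right] using h

/-- The `m`-th derivative of `(|y|² + c)^s` in a fixed direction `a`. The restriction to a line is a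
power of a quadratic polynomial. -/
theorem iteratedFDeriv_normPow_diag {c : ℝ} (hc : 0 < c) (s : ℝ) (a : Euc n) (m : ℕ) (y : Euc n) :
    iteratedFDeriv ℝ m (normPow c s : Euc n → ℝ) y (fun _ => a) =
      ∑ l ∈ Finset.range (m + 1), derivCoeff m l * (∏ p ∈ Finset.range (m - l), (s - p)) *
        inner ℝ a y ^ (m - 2 * l) * (‖a‖ ^ 2) ^ l * normPow c (s - (m - l : ℕ)) y := by
  induction m generalizing y with
  | zero => simp [derivCoeff]
  | succ m ih =>
    have hdiff : DifferentiableAt ℝ (iteratedFDeriv ℝ m (normPow c s : Euc n → ℝ)) y :=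
      ((contDiff_normPow hc s (k := ∞)).differentiable_iteratedFDeriv
        (by exact_mod_cast ENat.natCast_lt_top m)) y
    have h1 : iteratedFDeriv ℝ (m + 1) (normPow c s : Euc n → ℝ) y (fun _ => a) =
        lineDeriv ℝ (fun z => iteratedFDeriv ℝ m (normPow c s : Euc n → ℝ) z fun _ => a) y a := by
      rw [iteratedFDeriv_succ_apply_left, DifferentiableAt.lineDeriv_eq_fderiv
        (hdiff.continuousMultilinear_apply_const _), fderiv_continuousMultilinear_apply_const_apply
        hdiff]
      rfl
    rw [h1, funext ih]
    let F (l : ℕ) : ℝ := (∏ p ∈ Finset.range (m + 1 - l), (s - p)) *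
        inner ℝ a y ^ (m + 1 - 2 * l) * (‖a‖ ^ 2) ^ l * normPow c (s - (m + 1 - l : ℕ)) y
    have h2 : HasLineDerivAt ℝ (fun z : Euc n => ∑ l ∈ Finset.range (m + 1),
        derivCoeff m l * (∏ p ∈ Finset.range (m - l), (s - p)) *
        inner ℝ a z ^ (m - 2 * l) * (‖a‖ ^ 2) ^ l * normPow c (s - (m - l : ℕ)) z)
        (∑ l ∈ Finset.range (m + 1), ((m - 2 * l : ℕ) * derivCoeff m l * F (l + 1) +
          2 * derivCoeff m l * F l)) y a := by
      refine HasDerivAt.fun_sum fun l hl => ?_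
      have hl' := Finset.mem_range.1 hl
      rcases Nat.lt_or_ge m (2 * l) with h | h
      · simp only [derivCoeff_eq_zero h, Nat.cast_zero, zero_mul, mul_zero, add_zero]
        exact hasDerivAt_const _ _
      · have h3 := ((((hasDerivAt_line_inner y a).fun_pow (m - 2 * l)).const_mul
          (derivCoeff m l * (∏ p ∈ Finset.range (m - l), (s - p)))).mul_const ((‖a‖ ^ 2) ^ l)).mul
          (hasDerivAt_line_normPow hc (s - (m - l : ℕ)) y a)
        refine h3.congr_deriv ?_
        rw [zero_smul, add_zero]
        simp only [F]
        rw [show m + 1 - (l + 1) = m - l by omega, show m + 1 - 2 * (l + 1) = m - 2 * l - 1 by omega,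
          show m + 1 - l = m - l + 1 by omega, show m + 1 - 2 * l = m - 2 * l + 1 by omega,
          Finset.prod_range_succ, Nat.cast_add_one, ← sub_sub]
        ring
    rw [h2.lineDeriv]
    have h4 : ∑ l ∈ Finset.range (m + 1 + 1), derivCoeff (m + 1) l *
        (∏ p ∈ Finset.range (m + 1 - l), (s - p)) * inner ℝ a y ^ (m + 1 - 2 * l) *
        (‖a‖ ^ 2) ^ l * normPow c (s - (m + 1 - l : ℕ)) y =
        ∑ l ∈ Finset.range (m + 1 + 1), derivCoeff (m + 1) l * F l :=
      Finset.sum_congr rfl fun l _ => by simp only [F]; ring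
    have h5 : ∑ l ∈ Finset.range (m + 1), 2 * derivCoeff m l * F l =
        ∑ l ∈ Finset.range (m + 1 + 1), 2 * derivCoeff m l * F l := by
      rw [Finset.sum_range_succ _ (m + 1), derivCoeff_eq_zero (l := m + 1) (by omega)]
      simp
    rw [h4, Finset.sum_add_distrib, h5, Finset.sum_range_succ' _ (m + 1),
      Finset.sum_range_succ' _ (m + 1), ← add_assoc, ← Finset.sum_add_distrib]
    congr 1
    · refine Finset.sum_congr rfl fun l _ => ?_
      rw [derivCoeff]; push_cast; ring
    · rw [derivCoeff]; push_cast; ring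

/-- The exponent `s = (1 - n) / 2` produces the constants `c_{l,m}`. -/
theorem derivCoeff_mul_prod {n l m : ℕ} (h : 2 * l ≤ m) :
    derivCoeff m l * (∏ p ∈ Finset.range (m - l), ((1 - (n : ℝ)) / 2 - p)) =
      (-1) ^ m * coeff n l m := by
  obtain ⟨k, rfl⟩ : ∃ k, m = k + 2 * l := ⟨m - 2 * l, by omega⟩
  have h1 : (derivCoeff (k + 2 * l) l : ℝ) =
      (k + 2 * l).factorial * 2 ^ k / (l.factorial * k.factorial) := by
    rw [eq_div_iff (by positivity)]
    exact_mod_cast derivCoeff_mul l k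
  have h2 : ∏ p ∈ Finset.range (k + l), ((1 - (n : ℝ)) / 2 - p) =
      (-1 / 2) ^ (k + l) * ∏ p ∈ Finset.range (k + l), ((n : ℝ) - 1 + 2 * p) := by
    have h (p : ℕ) : (1 - (n : ℝ)) / 2 - p = -1 / 2 * ((n : ℝ) - 1 + 2 * p) := by ring
    simp only [h, Finset.prod_mul_distrib, Finset.prod_const, Finset.card_range]
  have h3 : ((-1 : ℝ) / 2) ^ (k + l) * 2 ^ k = (-1) ^ (k + 2 * l) * ((-1) ^ l / 2 ^ l) := by
    rw [div_pow, pow_add (2 : ℝ), pow_add (-1 : ℝ) k (2 * l), pow_mul (-1 : ℝ) 2 l,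
      pow_add (-1 : ℝ) k l]
    field_simp
    simp
  rw [coeff, show k + 2 * l - l = k + l by omega, show k + 2 * l - 2 * l = k by omega, h1, h2]
  calc _ = ((-1 / 2) ^ (k + l) * 2 ^ k) * ((∏ p ∈ Finset.range (k + l), ((n : ℝ) - 1 + 2 * p)) *
        (k + 2 * l).factorial / (l.factorial * k.factorial)) := by ring
    _ = _ := by
      rw [h3]
      field_simp

theorem contract_iteratedFDeriv {m : ℕ} (f : Euc n → ℝ) (y a : Euc n) :
    contract (fun I : Fin m → Fin n => iteratedFDeriv ℝ m f y
      fun k => EuclideanSpace.single (I k) 1) a = iteratedFDeriv ℝ m f y fun _ => a := by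
  have ha : a = ∑ i, a i • (EuclideanSpace.single i 1 : Euc n) := by
    simpa using ((EuclideanSpace.basisFun (Fin n) ℝ).sum_repr a).symm
  conv_rhs => rw [ha]
  have h := (iteratedFDeriv ℝ m f y).toMultilinearMap.map_sum
    (g := fun _ i => a i • (EuclideanSpace.single i 1 : Euc n))
  refine Eq.trans ?_ h.symm
  refine Finset.sum_congr rfl fun I _ => ?_
  exact ((iteratedFDeriv ℝ m f y).map_smul_univ (fun k => a (I k)) _).symm

theorem two_mul_le_of_fin {m : ℕ} (l : Fin (m / 2 + 1)) : 2 * (l : ℕ) ≤ m := by omega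

/-- The derivatives of `(|y|² + c)^{(1-n)/2}` are, up to sign, the combination of the tensors
`i^l j^l y^m` with the coefficients `c_{l,m}`. Both sides are symmetric, so that it suffices to
compare the derivatives in a single direction. -/
theorem iteratedFDeriv_normPow {c : ℝ} (hc : 0 < c) {m : ℕ} (I : Fin m → Fin n) {y : Euc n}
    (hy : y ≠ 0) :
    iteratedFDeriv ℝ m (normPow c ((1 - (n : ℝ)) / 2) : Euc n → ℝ) y
      (fun k => EuclideanSpace.single (I k) 1) =
    (-1) ^ m * ∑ l : Fin (m / 2 + 1), coeff n l m *
      metricTrace l (two_mul_le_of_fin l) (monomial y) I * ((‖y‖ ^ 2) ^ (l : ℕ))⁻¹ *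
        normPow c ((1 - (n : ℝ)) / 2 - (m - l : ℕ)) y := by
  refine congrFun (IsSymm.eq_of_contract_eq
    (u := fun I : Fin m → Fin n => iteratedFDeriv ℝ m
      (normPow c ((1 - (n : ℝ)) / 2) : Euc n → ℝ) y (fun k => EuclideanSpace.single (I k) 1))
    (v := fun I : Fin m → Fin n => (-1) ^ m * ∑ l : Fin (m / 2 + 1), coeff n l m *
      metricTrace l (two_mul_le_of_fin l) (monomial y) I * ((‖y‖ ^ 2) ^ (l : ℕ))⁻¹ *
        normPow c ((1 - (n : ℝ)) / 2 - (m - l : ℕ)) y)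
    (fun π I => ?_) (fun π I => ?_) fun a => ?_) I
  · exact ContDiffAt.iteratedFDeriv_comp_perm (contDiff_normPow hc _).contDiffAt
      (fun k => EuclideanSpace.single (I k) 1) π
  · refine congrArg ((-1) ^ m * ·) (Finset.sum_congr rfl fun l _ => ?_)
    rw [isSymm_metricTrace_monomial _ y π I]
  · rw [contract_iteratedFDeriv, iteratedFDeriv_normPow_diag hc]
    have h1 : contract (fun I : Fin m → Fin n => (-1) ^ m * ∑ l : Fin (m / 2 + 1), coeff n l m *
        metricTrace l (two_mul_le_of_fin l) (monomial y) I * ((‖y‖ ^ 2) ^ (l : ℕ))⁻¹ *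
          normPow c ((1 - (n : ℝ)) / 2 - (m - l : ℕ)) y) a =
        (-1) ^ m * ∑ l : Fin (m / 2 + 1), coeff n l m *
          contract (metricTrace l (two_mul_le_of_fin l) (monomial y)) a * ((‖y‖ ^ 2) ^ (l : ℕ))⁻¹ *
          normPow c ((1 - (n : ℝ)) / 2 - (m - l : ℕ)) y := by
      simp only [contract, Finset.mul_sum, Finset.sum_mul]
      rw [Finset.sum_comm]
      refine Finset.sum_congr rfl fun l _ => Finset.sum_congr rfl fun I _ => ?_
      ring
    rw [h1]
    simp only [contract_metricTrace_monomial]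
    rw [Fin.sum_univ_eq_sum_range (fun l => coeff n l m * ((‖a‖ ^ 2) ^ l * (‖y‖ ^ 2) ^ l *
      inner ℝ a y ^ (m - 2 * l)) * ((‖y‖ ^ 2) ^ l)⁻¹ *
        normPow c ((1 - (n : ℝ)) / 2 - (m - l : ℕ)) y) (m / 2 + 1),
      ← Finset.sum_subset (Finset.range_mono (by omega : m / 2 + 1 ≤ m + 1)), Finset.mul_sum]
    · refine Finset.sum_congr rfl fun l hl => ?_
      have hl' := Finset.mem_range.1 hl
      rw [derivCoeff_mul_prod (by omega)]
      have : (‖y‖ ^ 2) ^ l ≠ 0 := by positivity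
      field_simp
    · intro l _ hl
      rw [Finset.mem_range] at hl
      rw [derivCoeff_eq_zero (by omega)]
      simp

end Kernel

/-! ### Line averages as convolutions -/

section Polar

variable {n : ℕ}

instance : SigmaFinite (Measure.comap (Subtype.val : Set.Ioi (0 : ℝ) → ℝ) volume) :=
  SigmaFinite.of_map _ measurable_subtype_coe.aemeasurable
    (by rw [map_comap_subtype_coe measurableSet_Ioi]; infer_instance)

theorem map_prod_comap_Ioi :
    ((sphereMeasure n).prod (Measure.comap (Subtype.val : Set.Ioi (0 : ℝ) → ℝ) volume)).map
      (Prod.map id Subtype.val) = (sphereMeasure n).prod (volume.restrict (Set.Ioi 0)) := by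
  rw [← Measure.map_prod_map _ _ measurable_id measurable_subtype_coe, Measure.map_id,
    map_comap_subtype_coe measurableSet_Ioi]

theorem measurableEmbedding_prodMap_Ioi : MeasurableEmbedding
    (Prod.map id Subtype.val : USphere n × Set.Ioi (0 : ℝ) → USphere n × ℝ) :=
  MeasurableEmbedding.id.prodMap (.subtype_coe measurableSet_Ioi)

theorem prod_volumeIoiPow (k : ℕ) : (sphereMeasure n).prod (Measure.volumeIoiPow k) =
    ((sphereMeasure n).prod (Measure.comap (Subtype.val : Set.Ioi (0 : ℝ) → ℝ) volume)).withDensity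
      fun p => (Real.toNNReal (p.2.1 ^ k) : ENNReal) := by
  rw [Measure.volumeIoiPow, prod_withDensity_right]
  · rfl
  · fun_prop

/-- Integration in polar coordinates. -/
theorem integrable_iff_and_integral_polar (hn : n ≠ 0) (H : Euc n → ℝ) :
    (Integrable H ↔
      Integrable (fun p : USphere n × ℝ => p.2 ^ (n - 1) * H (p.2 • (p.1 : Euc n)))
        ((sphereMeasure n).prod (volume.restrict (Set.Ioi 0)))) ∧
    ∫ y, H y = ∫ p : USphere n × ℝ, p.2 ^ (n - 1) * H (p.2 • (p.1 : Euc n))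
      ∂((sphereMeasure n).prod (volume.restrict (Set.Ioi 0))) := by
  have : Nonempty (Fin n) := ⟨⟨0, Nat.pos_of_ne_zero hn⟩⟩
  have h0 : MeasurePreserving (homeomorphUnitSphereProd (Euc n))
      (volume.comap (Subtype.val : ({0}ᶜ : Set (Euc n)) → Euc n))
      (((sphereMeasure n).prod
        (Measure.comap (Subtype.val : Set.Ioi (0 : ℝ) → ℝ) volume)).withDensity
        fun p => (Real.toNNReal (p.2.1 ^ (n - 1)) : ENNReal)) := by
    have := (volume : Measure (Euc n)).measurePreserving_homeomorphUnitSphereProd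
    rwa [finrank_euclideanSpace_fin, prod_volumeIoiPow] at this
  have hd : Measurable fun p : USphere n × Set.Ioi (0 : ℝ) => Real.toNNReal (p.2.1 ^ (n - 1)) := by
    fun_prop
  let G (p : USphere n × Set.Ioi (0 : ℝ)) : ℝ := H (p.2.1 • (p.1 : Euc n))
  have hG (y : ({(0)}ᶜ : Set (Euc n))) : G (homeomorphUnitSphereProd (Euc n) y) = H y := by
    have hy : ‖(y : Euc n)‖ ≠ 0 := norm_ne_zero_iff.2 y.2
    simp [G, smul_smul, hy]
  have hS (p : USphere n × Set.Ioi (0 : ℝ)) :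
      Real.toNNReal (p.2.1 ^ (n - 1)) • G p = p.2.1 ^ (n - 1) * H (p.2.1 • (p.1 : Euc n)) := by
    have : 0 ≤ p.2.1 ^ (n - 1) := pow_nonneg (le_of_lt p.2.2) _
    simp [G, NNReal.smul_def, this]
  rw [← map_prod_comap_Ioi, measurableEmbedding_prodMap_Ioi.integral_map,
    measurableEmbedding_prodMap_Ioi.integrable_map_iff]
  constructor
  · have h1 := h0.integrable_comp_emb (Homeomorph.measurableEmbedding _) (g := G)
    rw [integrable_withDensity_iff_integrable_smul hd] at h1
    simp only [Function.comp_def, hG, hS] at h1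
    refine Iff.trans ?_ h1
    have h2 : Integrable H ↔ Integrable H (volume.restrict {(0 : Euc n)}ᶜ) := by
      rw [restrict_compl_singleton]
    rw [h2, ← map_comap_subtype_coe (measurableSet_singleton (0 : Euc n)).compl,
      (MeasurableEmbedding.subtype_coe
        (measurableSet_singleton (0 : Euc n)).compl).integrable_map_iff]
    rfl
  · have h1 : ∫ y, H y = ∫ y : ({(0)}ᶜ : Set (Euc n)), H y.1
        ∂(volume.comap (Subtype.val : ({0}ᶜ : Set (Euc n)) → Euc n)) := by
      rw [integral_subtype_comap (measurableSet_singleton _).compl H, restrict_compl_singleton]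
    have h2 := h0.integral_comp (Homeomorph.measurableEmbedding _) G
    rw [integral_withDensity_eq_integral_smul hd] at h2
    simp only [hG, hS] at h2
    rw [h1, h2]
    rfl

/-- The line average with an even weight `w` is the convolution with twice the kernel
`|y|^{1-n} w(y/|y|)`. -/
theorem integrable_and_lineAvg_eq (hn : n ≠ 0) {w : USphere n → ℝ} (hw : Continuous w) {B : ℝ}
    (hB : ∀ ξ, |w ξ| ≤ B) {k : Euc n → ℝ}
    (hk : ∀ (ξ : USphere n) (r : ℝ), 0 < r → k (r • (ξ : Euc n)) = r ^ (1 - n : ℝ) * w ξ)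
    (hk' : ∀ y, k (-y) = k y) (φ : Test n) (x : Euc n) :
    Integrable (fun y => k (y - x) * φ y) ∧ lineAvg w φ x = 2 * ∫ y, k (y - x) * φ y := by
  obtain ⟨R, hR⟩ := exists_radius φ
  obtain ⟨M, hM⟩ := exists_norm_bound φ.continuous hR
  let F (p : USphere n × ℝ) : ℝ := w p.1 * φ (x + p.2 • (p.1 : Euc n))
  have hF : Integrable F ((sphereMeasure n).prod volume) :=
    lineAvg_integrable hw hB φ.continuous hM hR x
  have hμ (s : Set ℝ) : (sphereMeasure n).prod (volume.restrict s) =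
      ((sphereMeasure n).prod volume).restrict (Set.univ ×ˢ s) := by
    rw [← Measure.prod_restrict, Measure.restrict_univ]
  have hrad (ξ : USphere n) (r : ℝ) (hr : 0 < r) : r ^ (n - 1) * k (r • (ξ : Euc n)) = w ξ := by
    rw [hk ξ r hr, ← mul_assoc, ← Real.rpow_natCast, ← Real.rpow_add hr,
      Nat.cast_pred (Nat.pos_of_ne_zero hn)]
    simp
  -- the half line `t > 0`
  have hpos : ∀ᵐ p ∂((sphereMeasure n).prod (volume.restrict (Set.Ioi (0 : ℝ)))),
      p.2 ^ (n - 1) * (k (p.2 • (p.1 : Euc n)) * φ (x + p.2 • (p.1 : Euc n))) = F p := by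
    rw [hμ]
    filter_upwards [ae_restrict_mem (MeasurableSet.univ.prod measurableSet_Ioi)] with p hp
    rw [← mul_assoc, hrad p.1 p.2 hp.2]
  have hF1 : Integrable F ((sphereMeasure n).prod (volume.restrict (Set.Ioi (0 : ℝ)))) := by
    rw [hμ]; exact hF.restrict
  obtain ⟨i1, e1⟩ := integrable_iff_and_integral_polar hn fun y => k y * φ (x + y)
  rw [integral_congr_ae hpos] at e1
  rw [integrable_congr hpos] at i1
  -- the half line `t < 0`, by the reflection `y ↦ -y`
  have hneg : ∀ᵐ p ∂((sphereMeasure n).prod (volume.restrict (Set.Ioi (0 : ℝ)))),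
      p.2 ^ (n - 1) * (k (p.2 • (p.1 : Euc n)) * φ (x - p.2 • (p.1 : Euc n))) = F (p.1, -p.2) := by
    rw [hμ]
    filter_upwards [ae_restrict_mem (MeasurableSet.univ.prod measurableSet_Ioi)] with p hp
    rw [← mul_assoc, hrad p.1 p.2 hp.2]
    simp only [F, neg_smul, sub_eq_add_neg]
  obtain ⟨-, e2⟩ := integrable_iff_and_integral_polar hn fun y => k y * φ (x - y)
  rw [integral_congr_ae hneg] at e2
  have e3 : ∫ y, k y * φ (x - y) = ∫ y, k y * φ (x + y) := by
    rw [← integral_neg_eq_self]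
    simp only [hk', sub_neg_eq_add]
  have hmp : MeasurePreserving (Prod.map id Neg.neg : USphere n × ℝ → USphere n × ℝ)
      ((sphereMeasure n).prod volume) ((sphereMeasure n).prod volume) :=
    (MeasurePreserving.id _).prod (Measure.measurePreserving_neg _)
  have e4 : ∫ p in Set.univ ×ˢ Set.Iio (0 : ℝ), F p ∂((sphereMeasure n).prod volume) =
      ∫ p, F (p.1, -p.2) ∂((sphereMeasure n).prod (volume.restrict (Set.Ioi (0 : ℝ)))) := by
    rw [hμ, ← hmp.setIntegral_preimage_emb
      (MeasurableEmbedding.id.prodMap (MeasurableEquiv.neg ℝ).measurableEmbedding)]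
    have : Prod.map id Neg.neg ⁻¹' (Set.univ ×ˢ Set.Iio (0 : ℝ)) =
        (Set.univ ×ˢ Set.Ioi (0 : ℝ) : Set (USphere n × ℝ)) := by
      ext p; simp
    rw [this]
    rfl
  have e5 : ∫ p in Set.univ ×ˢ Set.Iic (0 : ℝ), F p ∂((sphereMeasure n).prod volume) =
      ∫ p in Set.univ ×ˢ Set.Iio (0 : ℝ), F p ∂((sphereMeasure n).prod volume) := by
    rw [← hμ, ← hμ, restrict_Iio_eq_restrict_Iic]
  have hc : (Set.univ ×ˢ Set.Ioi (0 : ℝ) : Set (USphere n × ℝ))ᶜ = Set.univ ×ˢ Set.Iic 0 := by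
    ext p; simp
  have e6 := integral_add_compl (MeasurableSet.univ.prod measurableSet_Ioi) hF
    (s := (Set.univ ×ˢ Set.Ioi (0 : ℝ) : Set (USphere n × ℝ)))
  rw [hc, e5, e4, ← e2, e3, ← hμ, ← e1] at e6
  have ht : (fun y => k (y - x) * φ y) =
      fun y => (fun z => k z * φ (x + z)) (y - x) := by
    funext y; simp
  constructor
  · rw [ht]
    exact (i1.2 hF1).comp_sub_right x
  · rw [ht, integral_sub_right_eq_self (fun z => k z * φ (x + z)) x, two_mul, e6]
    rfl

end Polar

/-! ### Moving derivatives onto the kernel -/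

section Kernel

variable {n m : ℕ}

theorem lineDerivOp_test_apply (φ : Test n) (v x : Euc n) : (∂_{v} φ) x = fderiv ℝ φ x v := by
  change (TestFunction.lineDerivCLM ℝ v φ : Test n) x = _
  rw [TestFunction.lineDerivCLM_apply_of_le (by simp),
    (φ.contDiff.differentiable (by simp)).differentiableAt.lineDeriv_eq_fderiv]

theorem mulSmooth_apply (χ : Test n) (g : Euc n → ℝ) (hg : ContDiff ℝ ∞ g) (x : Euc n) :
    mulSmooth χ g hg x = χ x * g x := rfl

theorem integral_iteratedLineDerivOp_mul (φ : Test n) {g : Euc n → ℝ} (hg : ContDiff ℝ ω g)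
    (v : Fin m → Euc n) :
    ∫ y, (∂^{v} φ) y * g y = (-1) ^ m * ∫ y, φ y * iteratedFDeriv ℝ m g y v := by
  induction m generalizing φ with
  | zero => simp
  | succ m ih =>
    have hsm : ContDiff ℝ 1 (iteratedFDeriv ℝ m g) :=
      hg.iteratedFDeriv_right (by simp)
    have hG : ContDiff ℝ 1 fun y => iteratedFDeriv ℝ m g y (Fin.init v) :=
      (ContinuousMultilinearMap.apply ℝ (fun _ : Fin m => Euc n) ℝ (Fin.init v)).contDiff.comp hsm
    have hder (y : Euc n) : fderiv ℝ (fun y => iteratedFDeriv ℝ m g y (Fin.init v)) y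
        (v (Fin.last m)) = iteratedFDeriv ℝ (m + 1) g y v := by
      have h := Fin.cons_removeNth_eq_comp_cycleRange_symm v (Fin.last m)
      rw [Fin.removeNth_last] at h
      rw [fderiv_continuousMultilinear_apply_const_apply (hsm.differentiable one_ne_zero y),
        ← hg.contDiffAt.iteratedFDeriv_comp_perm v (Fin.last m).cycleRange.symm, ← h,
        iteratedFDeriv_succ_apply_left]
      rfl
    rw [iteratedLineDerivOp_succ_right, ih]
    have hint (ψ : Test n) {k : Euc n → ℝ} (hk : Continuous k) : Integrable fun y => ψ y * k y :=
      (ψ.continuous.mul hk).integrable_of_hasCompactSupport ψ.hasCompactSupport.mul_right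
    have h1 : Continuous fun y => fderiv ℝ (fun y => iteratedFDeriv ℝ m g y (Fin.init v)) y
        (v (Fin.last m)) := (hG.continuous_fderiv one_ne_zero).clm_apply continuous_const
    have h2 := integral_mul_fderiv_eq_neg_fderiv_mul_of_integrable (μ := volume)
      (f := φ) (g := fun y => iteratedFDeriv ℝ m g y (Fin.init v)) (v := v (Fin.last m))
      (by simpa only [lineDerivOp_test_apply] using hint (∂_{v (Fin.last m)} φ) hG.continuous)
      (hint φ h1) (hint φ hG.continuous)
      (fun y _ => (φ.contDiff.differentiable (by simp)) y)
      (fun y _ => (hG.differentiable one_ne_zero) y)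
    simp only [hder] at h2
    simp only [lineDerivOp_test_apply]
    rw [h2, pow_succ]
    ring

theorem continuous_monomial (I : Fin m → Fin n) : Continuous fun y : Euc n => monomial y I := by
  unfold monomial; fun_prop

theorem contDiff_monomial_sub (x : Euc n) (I : Fin m → Fin n) :
    ContDiff ℝ ∞ fun y : Euc n => monomial (y - x) I := by
  unfold monomial; fun_prop

theorem continuous_metricTrace_monomial {l : ℕ} (h : 2 * l ≤ m) (I : Fin m → Fin n) :
    Continuous fun y : Euc n => metricTrace l h (monomial y) I := by
  let g (I : Fin m → Fin n) : C(Euc n, ℝ) := ⟨_, continuous_monomial I⟩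
  have (y : Euc n) : metricTrace l h g I y = metricTrace l h (monomial y) I :=
    map_metricTrace (ContinuousMap.evalCLM ℝ y : C(Euc n, ℝ) →L[ℝ] ℝ).toLinearMap h g I
  simp only [← this]
  exact (metricTrace l h g I).continuous

theorem metricTrace_monomial_smul {l : ℕ} (h : 2 * l ≤ m) (c : ℝ) (y : Euc n)
    (I : Fin m → Fin n) :
    metricTrace l h (monomial (c • y)) I = c ^ m * metricTrace l h (monomial y) I := by
  rw [← smul_eq_mul, ← metricTrace_smul]
  congr 1
  funext K
  rw [monomial_smul, smul_eq_mul]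

theorem exists_metricTrace_bound {l : ℕ} (h : 2 * l ≤ m) (I : Fin m → Fin n) :
    ∃ B, ∀ y : Euc n, |metricTrace l h (monomial y) I| ≤ B * ‖y‖ ^ m := by
  obtain ⟨B, hB⟩ := (isCompact_closedBall (0 : Euc n) 1).exists_bound_of_continuousOn
    (continuous_metricTrace_monomial h I).continuousOn
  refine ⟨B, fun y => ?_⟩
  have h1 : ‖y‖ • (‖y‖⁻¹ • y) = y := by
    rcases eq_or_ne y 0 with rfl | hy
    · simp
    · rw [smul_smul, mul_inv_cancel₀ (norm_ne_zero_iff.2 hy), one_smul]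
  have h2 := hB (‖y‖⁻¹ • y) (by
    rw [mem_closedBall_zero_iff, norm_smul, norm_inv, norm_norm]
    exact inv_mul_le_one)
  conv_lhs => rw [← h1, metricTrace_monomial_smul, abs_mul, abs_of_nonneg (by positivity)]
  rw [mul_comm]
  exact mul_le_mul_of_nonneg_right h2 (by positivity)

theorem abs_monomial_le_norm_pow (y : Euc n) (I : Fin m → Fin n) : |monomial y I| ≤ ‖y‖ ^ m := by
  rw [monomial, Finset.abs_prod]
  refine (Finset.prod_le_prod (fun _ _ => abs_nonneg _)
    fun k _ => PiLp.norm_apply_le y (I k)).trans ?_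
  simp

/-- The component `(∑_l c_{l,m} i^l j^l y^m)_I`, where `y^m` is the tensor with components
`y_{i₁} ⋯ y_{i_m}`. -/
noncomputable def traceSum (y : Euc n) (I : Fin m → Fin n) : ℝ :=
  ∑ l : Fin (m / 2 + 1), coeff n l m * metricTrace l (two_mul_le_of_fin l) (monomial y) I

theorem traceSum_smul (c : ℝ) (y : Euc n) (I : Fin m → Fin n) :
    traceSum (c • y) I = c ^ m * traceSum y I := by
  simp only [traceSum, metricTrace_monomial_smul, Finset.mul_sum]
  exact Finset.sum_congr rfl fun l _ => by ring

theorem continuous_traceSum (I : Fin m → Fin n) : Continuous fun y : Euc n => traceSum y I :=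
  continuous_finsetSum _ fun l _ =>
    continuous_const.mul (continuous_metricTrace_monomial (two_mul_le_of_fin l) I)

/-- The convolution kernel of `lineAvg (ξ_K ∑_l c_{l,m} (i^l j^l ξ^m)_I)`, up to a factor `2`. -/
noncomputable def traceKernel (K I : Fin m → Fin n) (z : Euc n) : ℝ :=
  monomial z K * traceSum z I * (‖z‖ ^ 2) ^ ((1 - n : ℝ) / 2 - m)

theorem sq_rpow {r : ℝ} (hr : 0 ≤ r) (s : ℝ) : (r ^ 2) ^ s = r ^ (2 * s) := by
  rw [Real.rpow_mul hr, Real.rpow_two]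

theorem traceKernel_smul (K I : Fin m → Fin n) (ξ : USphere n) {r : ℝ} (hr : 0 < r) :
    traceKernel K I (r • (ξ : Euc n)) =
      r ^ (1 - n : ℝ) * (monomial (ξ : Euc n) K * traceSum (ξ : Euc n) I) := by
  have h1 : ‖r • (ξ : Euc n)‖ = r := by simp [norm_smul, hr.le]
  have h2 : r ^ m * r ^ m * r ^ (2 * ((1 - n : ℝ) / 2 - m)) = r ^ (1 - n : ℝ) := by
    rw [← Real.rpow_natCast, ← Real.rpow_add hr, ← Real.rpow_add hr]
    congr 1
    ring
  rw [traceKernel, h1, sq_rpow hr.le, monomial_smul, traceSum_smul, ← h2]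
  ring

theorem traceKernel_neg (K I : Fin m → Fin n) (z : Euc n) :
    traceKernel K I (-z) = traceKernel K I z := by
  have h : ((-1 : ℝ) ^ m) * (-1) ^ m = 1 := by rw [← mul_pow]; simp
  rw [traceKernel, traceKernel, norm_neg, ← neg_one_smul ℝ z, monomial_smul, traceSum_smul]
  linear_combination (monomial z K * traceSum z I * (‖z‖ ^ 2) ^ ((1 - n : ℝ) / 2 - m)) * h

theorem tendsto_normPow {c : ℕ → ℝ} (hc : Filter.Tendsto c Filter.atTop (𝓝 0)) (s : ℝ) {z : Euc n}
    (hz : z ≠ 0) :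
    Filter.Tendsto (fun j => normPow (c j) s z) Filter.atTop (𝓝 ((‖z‖ ^ 2) ^ s)) := by
  have h : Filter.Tendsto (fun j => ‖z‖ ^ 2 + c j) Filter.atTop (𝓝 (‖z‖ ^ 2)) := by
    simpa using hc.const_add (‖z‖ ^ 2)
  exact h.rpow_const (.inl (by positivity))

theorem normPow_le {c s : ℝ} (hc : 0 < c) (hs : s ≤ 0) {z : Euc n} (hz : z ≠ 0) :
    normPow c s z ≤ (‖z‖ ^ 2) ^ s :=
  Real.rpow_le_rpow_of_nonpos (by positivity) (by linarith) hs

theorem inv_pow_mul_rpow {q : ℝ} (hq : 0 < q) (s : ℝ) {l : ℕ} (h : l ≤ m) :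
    (q ^ l)⁻¹ * q ^ (s - (m - l : ℕ)) = q ^ (s - m) := by
  rw [← Real.rpow_natCast, ← Real.rpow_neg hq.le, ← Real.rpow_add hq, Nat.cast_sub h]
  congr 1
  ring

theorem tendsto_monomial_mul_iteratedFDeriv {c : ℕ → ℝ} (hc0 : ∀ j, 0 < c j)
    (hc : Filter.Tendsto c Filter.atTop (𝓝 0)) (K I : Fin m → Fin n) {z : Euc n} (hz : z ≠ 0) :
    Filter.Tendsto (fun j => monomial z K * iteratedFDeriv ℝ m
      (normPow (c j) ((1 - (n : ℝ)) / 2) : Euc n → ℝ) z fun k => EuclideanSpace.single (I k) 1)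
      Filter.atTop (𝓝 ((-1) ^ m * traceKernel K I z)) := by
  have hq : 0 < ‖z‖ ^ 2 := by positivity
  simp only [iteratedFDeriv_normPow (hc0 _) I hz]
  have h1 : (-1) ^ m * traceKernel K I z = monomial z K * ((-1) ^ m *
      ∑ l : Fin (m / 2 + 1), coeff n l m * metricTrace l (two_mul_le_of_fin l) (monomial z) I *
        ((‖z‖ ^ 2) ^ (l : ℕ))⁻¹ * (‖z‖ ^ 2) ^ ((1 - (n : ℝ)) / 2 - (m - l : ℕ))) := by
    simp only [traceKernel, traceSum, Finset.mul_sum, Finset.sum_mul]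
    refine Finset.sum_congr rfl fun l _ => ?_
    rw [← inv_pow_mul_rpow hq _ (show (l : ℕ) ≤ m by omega)]
    ring
  rw [h1]
  exact (((tendsto_finsetSum _ fun l _ => (tendsto_normPow hc _ hz).const_mul _).const_mul
    _).const_mul _)

theorem exists_bound_monomial_mul_iteratedFDeriv (hn : n ≠ 0) (K I : Fin m → Fin n) :
    ∃ C, ∀ c, 0 < c → ∀ z : Euc n, z ≠ 0 → |monomial z K * iteratedFDeriv ℝ m
      (normPow c ((1 - (n : ℝ)) / 2) : Euc n → ℝ) z fun k => EuclideanSpace.single (I k) 1| ≤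
        C * ‖z‖ ^ (1 - n : ℝ) := by
  choose B hB using fun l : Fin (m / 2 + 1) =>
    exists_metricTrace_bound (two_mul_le_of_fin l) I
  refine ⟨∑ l : Fin (m / 2 + 1), |coeff n l m| * B l, fun c hc z hz => ?_⟩
  have hz' : 0 < ‖z‖ := norm_pos_iff.2 hz
  have hq : 0 < ‖z‖ ^ 2 := by positivity
  have hn' : (1 : ℝ) ≤ n := by exact_mod_cast Nat.one_le_iff_ne_zero.2 hn
  rw [iteratedFDeriv_normPow hc I hz, abs_mul, abs_mul, abs_pow, abs_neg, abs_one, one_pow, one_mul]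
  refine (mul_le_mul (abs_monomial_le_norm_pow z K) (Finset.abs_sum_le_sum_abs _ _) (abs_nonneg _)
    (by positivity)).trans ?_
  rw [Finset.mul_sum, Finset.sum_mul]
  refine Finset.sum_le_sum fun l _ => ?_
  have h1 : normPow c ((1 - (n : ℝ)) / 2 - (m - l : ℕ)) z ≤
      (‖z‖ ^ 2) ^ ((1 - (n : ℝ)) / 2 - (m - l : ℕ)) := normPow_le hc (by
    have : (0 : ℝ) ≤ (m - l : ℕ) := Nat.cast_nonneg _
    linarith) hz
  have h2 : 0 ≤ normPow c ((1 - (n : ℝ)) / 2 - (m - l : ℕ)) z := by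
    unfold normPow; positivity
  have h3 : ‖z‖ ^ m * ‖z‖ ^ m * (((‖z‖ ^ 2) ^ (l : ℕ))⁻¹ *
      (‖z‖ ^ 2) ^ ((1 - (n : ℝ)) / 2 - (m - l : ℕ))) = ‖z‖ ^ (1 - n : ℝ) := by
    rw [inv_pow_mul_rpow hq _ (show (l : ℕ) ≤ m by omega), sq_rpow hz'.le, ← Real.rpow_natCast,
      ← Real.rpow_add hz', ← Real.rpow_add hz']
    congr 1
    ring
  rw [abs_mul, abs_mul, abs_mul, abs_of_nonneg h2, abs_of_pos (inv_pos.2 (pow_pos hq l)), ← h3]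
  have h4 := hB l z
  have h5 : 0 ≤ B l * ‖z‖ ^ m := (abs_nonneg _).trans h4
  calc _ = ‖z‖ ^ m * |coeff n l m| * ((‖z‖ ^ 2) ^ (l : ℕ))⁻¹ *
        (|metricTrace l (two_mul_le_of_fin l) (monomial z) I| *
          normPow c ((1 - (n : ℝ)) / 2 - (m - l : ℕ)) z) := by ring
    _ ≤ ‖z‖ ^ m * |coeff n l m| * ((‖z‖ ^ 2) ^ (l : ℕ))⁻¹ *
        ((B l * ‖z‖ ^ m) * (‖z‖ ^ 2) ^ ((1 - (n : ℝ)) / 2 - (m - l : ℕ))) :=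
      mul_le_mul_of_nonneg_left (mul_le_mul h4 h1 h2 h5) (by positivity)
    _ = _ := by ring

/-- The derivatives `∂_I` of the test function `(y - x)_K φ`, averaged over the lines through `x`,
fall on the kernel `|y - x|^{1-n}` and turn it into the kernel of the average on the left. The
kernel is replaced by `(|y - x|² + c)^{(1-n)/2}` and `c` tends to zero; the factor `(y - x)_K`
compensates the singularities of the derivatives. -/
theorem lineAvg_traceSum (φ : Test n) (I K : Fin m → Fin n) (x : Euc n) :
    lineAvg (fun ξ => monomial (ξ : Euc n) K * traceSum (ξ : Euc n) I) φ x =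
      lineAvg (fun _ => 1) (∂^{fun k => (EuclideanSpace.single (I k) 1 : Euc n)}
        (mulSmooth φ (fun y => monomial (y - x) K) (contDiff_monomial_sub x K)) : Test n) x := by
  rcases eq_or_ne n 0 with rfl | hn
  · have : IsEmpty (USphere 0) := ⟨fun ξ => by
      have h : ‖(ξ : Euc 0)‖ = 1 := by simp
      rw [Subsingleton.elim (ξ : Euc 0) 0] at h
      simp at h⟩
    rw [lineAvg, lineAvg, integral_of_isEmpty, integral_of_isEmpty]
  have hw : Continuous fun ξ : USphere n => monomial (ξ : Euc n) K * traceSum (ξ : Euc n) I :=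
    ((continuous_monomial K).comp continuous_subtype_val).mul
      ((continuous_traceSum I).comp continuous_subtype_val)
  obtain ⟨B, hB⟩ := isCompact_univ.exists_bound_of_continuousOn hw.continuousOn
  obtain ⟨-, e1⟩ := integrable_and_lineAvg_eq hn hw (fun ξ => hB ξ trivial)
    (fun ξ r hr => traceKernel_smul K I ξ hr) (traceKernel_neg K I) φ x
  have hone (ψ : Test n) := integrable_and_lineAvg_eq hn (w := fun _ => 1) continuous_const
    (B := 1) (by simp) (k := fun z => ‖z‖ ^ (1 - n : ℝ))
    (fun ξ r hr => by simp [norm_smul, abs_of_pos hr]) (by simp) ψ x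
  set h : Test n := mulSmooth φ (fun y => monomial (y - x) K) (contDiff_monomial_sub x K) with hh
  set v : Fin m → Euc n := fun k => EuclideanSpace.single (I k) 1
  obtain ⟨i2, e2⟩ := hone (∂^{v} h)
  rw [e1, e2]
  congr 1
  let c (j : ℕ) : ℝ := 1 / ((j : ℝ) + 1)
  have hc0 (j : ℕ) : 0 < c j := by positivity
  have hc : Filter.Tendsto c Filter.atTop (𝓝 0) := tendsto_one_div_add_atTop_nhds_zero_nat
  have hn' : (1 : ℝ) ≤ n := by exact_mod_cast Nat.one_le_iff_ne_zero.2 hn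
  have hs : (1 - (n : ℝ)) / 2 ≤ 0 := by linarith
  have hne : ∀ᵐ y : Euc n, y ≠ x := by
    have : Nonempty (Fin n) := ⟨⟨0, Nat.pos_of_ne_zero hn⟩⟩
    rw [ae_iff]
    simp
  have hsq (z : Euc n) : (‖z‖ ^ 2) ^ ((1 - (n : ℝ)) / 2) = ‖z‖ ^ (1 - n : ℝ) := by
    rw [sq_rpow (norm_nonneg z)]
    congr 1
    ring
  let g (j : ℕ) (y : Euc n) : ℝ := normPow (c j) ((1 - (n : ℝ)) / 2) (y - x)
  have hg (j : ℕ) : ContDiff ℝ ω (g j) :=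
    (contDiff_normPow (hc0 j) _).comp (contDiff_id.sub contDiff_const)
  have t1 : Filter.Tendsto (fun j => ∫ y, (∂^{v} h) y * g j y) Filter.atTop
      (𝓝 (∫ y, ‖y - x‖ ^ (1 - n : ℝ) * (∂^{v} h) y)) := by
    refine tendsto_integral_of_dominated_convergence _ (fun j => ?_) i2.norm (fun j => ?_) ?_
    · exact ((∂^{v} h : Test n).continuous.mul (hg j).continuous).aestronglyMeasurable
    · filter_upwards [hne] with y hy
      have h1 := normPow_le (hc0 j) hs (sub_ne_zero.2 hy)
      have h2 : 0 ≤ g j y := by simp only [g, normPow]; positivity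
      rw [hsq] at h1
      rw [norm_mul, norm_mul, mul_comm, Real.norm_of_nonneg h2,
        Real.norm_of_nonneg (Real.rpow_nonneg (norm_nonneg _) _)]
      exact mul_le_mul_of_nonneg_right h1 (norm_nonneg _)
    · filter_upwards [hne] with y hy
      rw [mul_comm, ← hsq]
      exact (tendsto_normPow hc _ (sub_ne_zero.2 hy)).const_mul _
  have hval (j : ℕ) (y : Euc n) : h y * iteratedFDeriv ℝ m (g j) y v = φ y *
      (monomial (y - x) K * iteratedFDeriv ℝ m
        (normPow (c j) ((1 - (n : ℝ)) / 2) : Euc n → ℝ) (y - x) v) := by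
    simp only [g, iteratedFDeriv_comp_sub, hh, mulSmooth_apply, mul_assoc]
  have t2 : Filter.Tendsto (fun j => ∫ y, h y * iteratedFDeriv ℝ m (g j) y v) Filter.atTop
      (𝓝 (∫ y, φ y * ((-1) ^ m * traceKernel K I (y - x)))) := by
    obtain ⟨C, hC⟩ := exists_bound_monomial_mul_iteratedFDeriv hn K I
    obtain ⟨i3, -⟩ := hone φ
    refine tendsto_integral_of_dominated_convergence _ (fun j => ?_) (i3.norm.const_mul C)
      (fun j => ?_) ?_
    · have h1 : Continuous fun y => iteratedFDeriv ℝ m (g j) y v :=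
        (ContinuousMultilinearMap.apply ℝ (fun _ : Fin m => Euc n) ℝ v).continuous.comp
          ((hg j).continuous_iteratedFDeriv (by simp))
      exact (h.continuous.mul h1).aestronglyMeasurable
    · filter_upwards [hne] with y hy
      rw [hval, norm_mul (φ y), norm_mul (‖y - x‖ ^ (1 - n : ℝ)),
        Real.norm_of_nonneg (Real.rpow_nonneg (norm_nonneg _) _), ← mul_assoc, mul_comm]
      exact mul_le_mul_of_nonneg_right (hC _ (hc0 j) _ (sub_ne_zero.2 hy)) (norm_nonneg _)
    · filter_upwards [hne] with y hy
      simp only [hval]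
      exact (tendsto_monomial_mul_iteratedFDeriv hc0 hc K I (sub_ne_zero.2 hy)).const_mul _
  simp only [integral_iteratedLineDerivOp_mul h (hg _)] at t1
  rw [tendsto_nhds_unique t1 (t2.const_mul _), ← integral_const_mul]
  refine integral_congr_ae (.of_forall fun y => ?_)
  have h1 : ((-1 : ℝ) ^ m) * (-1) ^ m = 1 := by rw [← mul_pow]; simp
  linear_combination (-(traceKernel K I (y - x) * φ y)) * h1

end Kernel

/-! ### Alternated derivatives of test functions -/

section TestFunctions

variable {n m : ℕ}

theorem iteratedLineDerivOp_eq_iterOp {D : Type*} [LineDeriv (Euc n) D D] (J : Fin m → Fin n)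
    (T : D) : ∂^{fun k => (EuclideanSpace.single (J k) 1 : Euc n)} T =
      iterOp (fun i T => ∂_{(EuclideanSpace.single i 1 : Euc n)} T) J T := by
  induction m with
  | zero => rw [iterOp_zero]; rfl
  | succ m ih =>
    cases J using Fin.consCases with | _ j J =>
    rw [iteratedLineDerivOp_succ_left, iterOp_cons, ← ih]
    rfl

/-- The partial derivative `∂/∂x_i` of test functions. -/
noncomputable def partialTest (i : Fin n) : Test n →ₗ[ℝ] Test n :=
  (TestFunction.lineDerivCLM ℝ (EuclideanSpace.single i 1 : Euc n) :
    Test n →L[ℝ] Test n).toLinearMap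

theorem partialTest_apply (i : Fin n) (φ : Test n) (x : Euc n) :
    partialTest i φ x = fderiv ℝ φ x (EuclideanSpace.single i 1) :=
  lineDerivOp_test_apply φ _ x

theorem partialTest_comm (i j : Fin n) (φ : Test n) :
    partialTest i (partialTest j φ) = partialTest j (partialTest i φ) := by
  ext x
  have h (i : Fin n) : ⇑(partialTest i φ) = fun y => fderiv ℝ φ y (EuclideanSpace.single i 1) :=
    funext (partialTest_apply i φ)
  have h2 : (2 : WithTop ℕ∞) ≤ ∞ := WithTop.coe_le_coe.2 (le_top : (2 : ℕ∞) ≤ ⊤)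
  have hd : DifferentiableAt ℝ (fderiv ℝ φ) x :=
    (φ.contDiff.fderiv_right (m := 1) (by rwa [one_add_one_eq_two])).differentiable one_ne_zero x
  have hs : IsSymmSndFDerivAt ℝ φ x := φ.contDiff.contDiffAt.isSymmSndFDerivAt (by simpa using h2)
  rw [partialTest_apply, partialTest_apply, h, h, fderiv_clm_apply hd (differentiableAt_const _),
    fderiv_clm_apply hd (differentiableAt_const _)]
  simpa using hs.eq _ _

open MvPolynomial in
theorem hasFDerivAt_eval_sub (x : Euc n) (p : MvPolynomial (Fin n) ℝ) (y : Euc n) :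
    ∃ L : Euc n →L[ℝ] ℝ, HasFDerivAt (fun y : Euc n => eval (fun i => (y - x) i) p) L y ∧
      ∀ i, L (EuclideanSpace.single i 1) = eval (fun i => (y - x) i) (pderiv i p) := by
  induction p using MvPolynomial.induction_on with
  | C a => exact ⟨0, by simpa using hasFDerivAt_const a y, by simp⟩
  | add p q hp hq =>
    obtain ⟨L, hL, hL'⟩ := hp
    obtain ⟨M, hM, hM'⟩ := hq
    exact ⟨L + M, by simp only [map_add]; exact hL.add hM, fun i => by simp [hL', hM']⟩
  | mul_X p j hp =>
    obtain ⟨L, hL, hL'⟩ := hp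
    have hX : HasFDerivAt (fun y : Euc n => (y - x) j)
        (EuclideanSpace.proj j : Euc n →L[ℝ] ℝ) y := by
      simpa using (EuclideanSpace.proj j : Euc n →L[ℝ] ℝ).hasFDerivAt.sub_const (x j)
    refine ⟨_, by simp only [map_mul, eval_X]; exact hL.mul hX, fun i => ?_⟩
    simp [hL', pderiv_X, Pi.single_apply, apply_ite]

open MvPolynomial in
theorem contDiff_eval_sub (x : Euc n) (p : MvPolynomial (Fin n) ℝ) :
    ContDiff ℝ ∞ fun y : Euc n => eval (fun i => (y - x) i) p := by
  induction p using MvPolynomial.induction_on with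
  | C a => simpa using contDiff_const
  | add p q hp hq => simpa using hp.add hq
  | mul_X p j hp =>
    have hX : ContDiff ℝ ∞ fun y : Euc n => (y - x) j := by fun_prop
    simpa using hp.mul hX

theorem partialTest_mulSmooth_eval (x : Euc n) (i : Fin n) (p : MvPolynomial (Fin n) ℝ)
    (φ : Test n) :
    partialTest i (mulSmooth φ _ (contDiff_eval_sub x p)) =
      mulSmooth φ _ (contDiff_eval_sub x (MvPolynomial.pderiv i p)) +
        mulSmooth (partialTest i φ) _ (contDiff_eval_sub x p) := by
  ext y
  obtain ⟨L, hL, hL'⟩ := hasFDerivAt_eval_sub x p y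
  have hφ : HasFDerivAt φ (fderiv ℝ φ y) y :=
    (φ.contDiff.differentiable (by simp) y).hasFDerivAt
  have h : HasFDerivAt (mulSmooth φ _ (contDiff_eval_sub x p)) _ y := hφ.mul hL
  rw [partialTest_apply, h.fderiv]
  change _ = φ y * MvPolynomial.eval (fun i => (y - x) i) (MvPolynomial.pderiv i p) +
    partialTest i φ y * MvPolynomial.eval (fun i => (y - x) i) p
  rw [partialTest_apply, ← hL' i]
  simp [mul_comm]

/-- `φ ↦ ∫∫ φ(x + t ξ) dt dS_ξ` at a fixed point `x`, as a linear form on test functions. -/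
noncomputable def lineAvgAt (x : Euc n) : Test n →ₗ[ℝ] ℝ where
  toFun φ := lineAvg (fun _ => 1) φ x
  map_add' φ ψ := lineAvg_add continuous_const (B := 1) (by simp) φ ψ x
  map_smul' c φ := lineAvg_smul _ c φ x

theorem lineAvgAt_apply (x : Euc n) (φ : Test n) : lineAvgAt x φ = lineAvg (fun _ => 1) φ x := rfl

/-- After alternation only the terms survive in which all derivatives of `lineAvg_traceSum` fall on
the monomial `(y - x)_K`. -/
theorem alternateAll_lineAvg_traceSum (ψ : Test n) (K : Fin m → Fin n) (x : Euc n)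
    (I J : Fin m → Fin n) :
    alternateAll (fun I J => lineAvg (fun ξ => monomial (ξ : Euc n) K * traceSum (ξ : Euc n) I)
      ⇑(iterOp (fun i => partialTest i) J ψ) x) I J =
    alternateAll (fun I J => (permCount I K : ℝ) *
      lineAvg (fun _ => 1) ⇑(iterOp (fun i => partialTest i) J ψ) x) I J := by
  have hmul (φ : Test n) :
      mulSmooth φ (fun y => monomial (y - x) K) (contDiff_monomial_sub x K) =
      mulSmooth φ _ (contDiff_eval_sub x (∏ k, MvPolynomial.X (K k))) := by
    ext y
    simp [mulSmooth_apply, monomial, map_prod]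
  have h := alternateAll_leibniz (fun i => MvPolynomial.pderiv (R := ℝ) i) partialTest
    partialTest_comm (fun p φ => mulSmooth φ _ (contDiff_eval_sub x p))
    (partialTest_mulSmooth_eval x) (∏ k, MvPolynomial.X (K k)) ψ I J
  have h' := congrArg (lineAvgAt x) h
  rw [map_alternateAll, map_alternateAll] at h'
  refine Eq.trans ?_ (h'.trans ?_)
  · congr 1
    funext I J
    rw [lineAvg_traceSum, hmul, iteratedLineDerivOp_eq_iterOp]
    rfl
  · congr 1
    funext I J
    rw [← smul_eq_mul, ← lineAvgAt_apply, ← map_smul]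
    congr 1
    ext y
    change iterOp (fun i => partialTest i) J ψ y * MvPolynomial.eval (fun i => (y - x) i)
      (iterOp (fun i => MvPolynomial.pderiv (R := ℝ) i) I (∏ k, MvPolynomial.X (K k))) =
      (permCount I K : ℝ) * iterOp (fun i => partialTest i) J ψ y
    rw [iterOp_pderiv_prod_X, MvPolynomial.eval_C, mul_comm]

end TestFunctions

/-! ### The pairing of compactly supported distributions with smooth functions -/

section Pairing

variable {n m : ℕ}

theorem exists_common_cutoff (S T : CompDistr n) : ∃ χ : Test n,
    (∀ᶠ x in 𝓝ˢ (dsupport ⇑(S : Distr n)), χ x = 1) ∧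
      ∀ᶠ x in 𝓝ˢ (dsupport ⇑(T : Distr n)), χ x = 1 := by
  obtain ⟨χ, hχ⟩ := exists_cutoff (S.2.union T.2)
  rw [nhdsSet_union, Filter.eventually_sup] at hχ
  exact ⟨χ, hχ⟩

/-- `T ↦ ⟨T, g⟩` as a linear map. -/
noncomputable def pairLin (g : Euc n → ℝ) (hg : ContDiff ℝ ∞ g) : CompDistr n →ₗ[ℝ] ℂ where
  toFun T := pair T g hg
  map_add' S T := by
    obtain ⟨χ, hS, hT⟩ := exists_common_cutoff S T
    have hST : ∀ᶠ x in 𝓝ˢ (dsupport ⇑((S + T : CompDistr n) : Distr n)), χ x = 1 := by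
      have := Filter.eventually_sup.2 ⟨hS, hT⟩
      rw [← nhdsSet_union] at this
      exact this.filter_mono (nhdsSet_mono (dsupport_add_subset _ _))
    rw [pair_eq S g hg χ hS, pair_eq T g hg χ hT, pair_eq _ g hg χ hST]
    rfl
  map_smul' c T := by
    have hT : ∀ᶠ x in 𝓝ˢ (dsupport ⇑((c • T : CompDistr n) : Distr n)), cutoff T x = 1 := by
      refine (cutoff_eq_one T).filter_mono (nhdsSet_mono (dsupport_subset_dsupport ?_))
      intro s _ hs u hu
      change c • (T : Distr n) u = 0
      rw [hs u hu, smul_zero]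
    rw [pair_eq _ g hg _ hT]
    rfl

theorem pair_congr (T : CompDistr n) {g g' : Euc n → ℝ} (h : g = g') (hg : ContDiff ℝ ∞ g)
    (hg' : ContDiff ℝ ∞ g') : pair T g hg = pair T g' hg' := by
  subst h; rfl

theorem lineDerivOp_distr_apply (T : Distr n) (v : Euc n) (φ : Test n) :
    (∂_{v} T) φ = -T (∂_{v} φ) := by
  rw [lineDerivOp_apply_apply, map_neg]

theorem contDiff_fderiv_apply {g : Euc n → ℝ} (hg : ContDiff ℝ ∞ g) (v : Euc n) :
    ContDiff ℝ ∞ fun x => fderiv ℝ g x v :=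
  (hg.fderiv_right (by simp)).clm_apply contDiff_const

theorem pair_lineDerivOp (T : CompDistr n) (v : Euc n) (g : Euc n → ℝ) (hg : ContDiff ℝ ∞ g) :
    pair (∂_{v} T) g hg = -pair T (fun x => fderiv ℝ g x v) (contDiff_fderiv_apply hg v) := by
  have hT : ∀ᶠ x in 𝓝ˢ (dsupport ⇑((∂_{v} T : CompDistr n) : Distr n)), cutoff T x = 1 :=
    (cutoff_eq_one T).filter_mono (nhdsSet_mono (dsupport_lineDerivOp_subset v))
  rw [pair_eq _ g hg _ hT]
  change (∂_{v} (T : Distr n)) _ = -(T : Distr n) _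
  rw [lineDerivOp_distr_apply, neg_inj]
  -- the derivative of the cutoff function vanishes near the support of `T`
  have h : ∂_{v} (mulSmooth (cutoff T) g hg) =
      mulSmooth (cutoff T) (fun x => fderiv ℝ g x v) (contDiff_fderiv_apply hg v) +
        mulSmooth (∂_{v} (cutoff T)) g hg := by
    ext x
    have h1 : HasFDerivAt (mulSmooth (cutoff T) g hg) _ x :=
      ((cutoff T).contDiff.differentiable (by simp) x).hasFDerivAt.mul
        (hg.differentiable (by simp) x).hasFDerivAt
    change _ = cutoff T x * fderiv ℝ g x v + (∂_{v} (cutoff T)) x * g x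
    rw [lineDerivOp_test_apply, lineDerivOp_test_apply, h1.fderiv]
    simp [mul_comm]
  rw [h, map_add, add_eq_left]
  refine isVanishingOn_compl_dsupport _ _ fun x hx hxT => ?_
  have h1 : ⇑(cutoff T) =ᶠ[𝓝 x] fun _ => 1 := (cutoff_eq_one T).filter_mono (nhds_le_nhdsSet hxT)
  refine (notMem_tsupport_iff_eventuallyEq.2 ?_) hx
  filter_upwards [h1.eventuallyEq_nhds] with y hy
  change (∂_{v} (cutoff T)) y * g y = 0
  rw [lineDerivOp_test_apply, hy.fderiv_eq]
  simp

theorem contDiff_lineAvg_one (ψ : Test n) : ContDiff ℝ ∞ (lineAvg (fun _ => 1) ψ) := by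
  obtain ⟨R, hR⟩ := exists_radius ψ
  exact contDiff_lineAvg continuous_const (B := 1) (by simp) ψ.contDiff hR

theorem fderiv_lineAvg_one_apply (ψ : Test n) (i : Fin n) (x : Euc n) :
    fderiv ℝ (lineAvg (fun _ => 1) ψ) x (EuclideanSpace.single i 1) =
      lineAvg (fun _ => 1) (partialTest i ψ) x := by
  obtain ⟨R, hR⟩ := exists_radius ψ
  have h1 : ContDiff ℝ 1 ψ := ψ.contDiff.of_le (by simp)
  obtain ⟨M, hM⟩ := exists_norm_bound (h1.continuous_fderiv one_ne_zero) (fderiv_eq_zero_of_lt hR)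
  rw [fderiv_lineAvg continuous_const (B := 1) (by simp) h1 hR, lineAvg,
    ContinuousLinearMap.integral_apply (lineAvg_integrable continuous_const (B := 1) (by simp)
      (h1.continuous_fderiv one_ne_zero) hM (fderiv_eq_zero_of_lt hR) x)]
  refine integral_congr_ae (.of_forall fun p => ?_)
  simp [partialTest_apply]

/-- `⟨∂_J T, N₀ ψ⟩ = (-1)^m ⟨T, N₀ ∂_J ψ⟩`. -/
theorem pair_iterOp_lineAvg (T : CompDistr n) (ψ : Test n) (J : Fin m → Fin n) :
    pair (iterOp (fun i T => ∂_{(EuclideanSpace.single i 1 : Euc n)} T) J T)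
      (lineAvg (fun _ => 1) ψ) (contDiff_lineAvg_one ψ) =
    (-1 : ℝ) ^ m • pair T _ (contDiff_lineAvg_one (iterOp (fun i => partialTest i) J ψ)) := by
  induction m generalizing ψ with
  | zero => simp [iterOp_zero]
  | succ m ih =>
    cases J using Fin.consCases with | _ j J =>
    rw [iterOp_cons, pair_lineDerivOp, pair_congr _ (funext (fderiv_lineAvg_one_apply ψ j)) _
      (contDiff_lineAvg_one (partialTest j ψ)), ih, pow_succ, mul_neg_one, neg_smul,
      iterOp_cons]
    congr 2
    exact pair_congr _ (by rw [iterOp_comm _ partialTest_comm]) _ _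

/-- `(∂_J T)(ψ) = (-1)^m T(∂_J ψ)`. -/
theorem iterOp_distr_apply (T : Distr n) (ψ : Test n) (J : Fin m → Fin n) :
    iterOp (fun i T => ∂_{(EuclideanSpace.single i 1 : Euc n)} T) J T ψ =
      (-1 : ℝ) ^ m • T (iterOp (fun i => partialTest i) J ψ) := by
  induction m generalizing ψ with
  | zero => simp [iterOp_zero]
  | succ m ih =>
    cases J using Fin.consCases with | _ j J =>
    have h : ∂_{(EuclideanSpace.single j 1 : Euc n)} ψ = partialTest j ψ := rfl
    rw [iterOp_cons, lineDerivOp_distr_apply, h, ih, pow_succ, mul_neg_one, neg_smul, iterOp_cons,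
      iterOp_comm _ partialTest_comm]

theorem scalarNormalOp_apply (u : CompDistr n) (ψ : Test n) :
    scalarNormalOp u ψ = pair u _ (contDiff_lineAvg_one ψ) := by
  rw [scalarNormalOp, normalOp_apply, Fintype.sum_unique]
  refine pair_congr _ ?_ _ _
  rw [normalTest_single]
  simp [monomial]

end Pairing

/-! ### The two sides of the identity on a test function -/

section Main

variable {n m : ℕ}

theorem saintVenant_eq {D : Type*} [AddCommGroup D] [Module ℝ D] [LineDeriv (Euc n) D D]
    (f : TensorField n m D) : saintVenant f = alternateAll fun I J =>
      iterOp (fun i T => ∂_{(EuclideanSpace.single i 1 : Euc n)} T) J (f I) := by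
  simp only [← iteratedLineDerivOp_eq_iterOp]
  rfl

/-- The dependence of a line average on its weight, as a linear map. -/
noncomputable def lineAvgWeight (φ : Test n) (x : Euc n) : C(USphere n, ℝ) →ₗ[ℝ] ℝ where
  toFun w := lineAvg w φ x
  map_add' v w := by
    obtain ⟨R, hR⟩ := exists_radius φ
    obtain ⟨M, hM⟩ := exists_norm_bound φ.continuous hR
    have h (w : C(USphere n, ℝ)) : Integrable (fun p : USphere n × ℝ =>
        w p.1 • φ (x + p.2 • (p.1 : Euc n))) ((sphereMeasure n).prod volume) :=
      lineAvg_integrable w.continuous (B := ‖w‖) w.norm_coe_le_norm φ.continuous hM hR x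
    rw [lineAvg, lineAvg, lineAvg, ← integral_add (h v) (h w)]
    simp only [ContinuousMap.add_apply, add_smul]
  map_smul' c w := by
    rw [lineAvg, lineAvg, RingHom.id_apply, ← integral_smul]
    simp only [ContinuousMap.smul_apply, smul_assoc]

theorem sum_coeff_metricTrace_lineAvg (φ : Test n) (x : Euc n) (K I : Fin m → Fin n) :
    ∑ l : Fin (m / 2 + 1), coeff n l m * metricTrace l (two_mul_le_of_fin l)
      (fun I => lineAvg (fun ξ => monomial (ξ : Euc n) K * monomial (ξ : Euc n) I) φ x) I =
    lineAvg (fun ξ => monomial (ξ : Euc n) K * traceSum (ξ : Euc n) I) φ x := by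
  let w (I : Fin m → Fin n) : C(USphere n, ℝ) :=
    ⟨fun ξ => monomial (ξ : Euc n) K * monomial (ξ : Euc n) I, continuous_weight I K⟩
  have h1 (l : Fin (m / 2 + 1)) : metricTrace l (two_mul_le_of_fin l)
      (fun I => lineAvg (fun ξ => monomial (ξ : Euc n) K * monomial (ξ : Euc n) I) φ x) I =
      lineAvgWeight φ x (metricTrace l (two_mul_le_of_fin l) w I) :=
    (map_metricTrace (lineAvgWeight φ x) (two_mul_le_of_fin l) w I).symm
  have h3 : ∑ l : Fin (m / 2 + 1), coeff n l m * lineAvgWeight φ x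
      (metricTrace l (two_mul_le_of_fin l) w I) = lineAvgWeight φ x
        (∑ l : Fin (m / 2 + 1), coeff n l m • metricTrace l (two_mul_le_of_fin l) w I) := by
    simp only [map_sum, map_smul, smul_eq_mul]
  simp only [h1]
  rw [h3]
  change lineAvg _ φ x = _
  congr 1
  funext ξ
  have h2 (l : Fin (m / 2 + 1)) : metricTrace l (two_mul_le_of_fin l) w I ξ =
      monomial (ξ : Euc n) K • metricTrace l (two_mul_le_of_fin l) (monomial (ξ : Euc n)) I := by
    rw [← metricTrace_smul]
    exact map_metricTrace (ContinuousMap.evalCLM ℝ ξ : C(USphere n, ℝ) →L[ℝ] ℝ).toLinearMap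
      (two_mul_le_of_fin l) w I
  rw [ContinuousMap.sum_apply]
  simp only [ContinuousMap.smul_apply, h2, traceSum, smul_eq_mul, Finset.mul_sum]
  exact Finset.sum_congr rfl fun l _ => by ring

/-- The functional `(u_K)_K ↦ ∑_K ⟨f_K, u_K⟩` on tensors with components in the test functions. -/
noncomputable def tensorPairing (f : TensorField n m (CompDistr n)) :
    ((Fin m → Fin n) → Test n) →ₗ[ℝ] ℂ :=
  ∑ K, ((f K : Distr n) : Test n →L[ℝ] ℂ).toLinearMap ∘ₗ LinearMap.proj K

theorem tensorPairing_apply (f : TensorField n m (CompDistr n)) (u : (Fin m → Fin n) → Test n) :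
    tensorPairing f u = ∑ K, (f K : Distr n) (u K) := by
  simp [tensorPairing]
  rfl

/-- Evaluation of distributions at a test function. -/
noncomputable def evalDistr (ψ : Test n) : Distr n →ₗ[ℝ] ℂ where
  toFun T := T ψ
  map_add' _ _ := rfl
  map_smul' _ _ := rfl

/-- Test functions `u_{IK}` with `⟨(∑_l c_{l,m} i^l j^l N_m f)_I, φ⟩ = ∑_K ⟨f_K, u_{IK}⟩`. Each one is
a line average of `φ`, cut off outside of a neighbourhood of the support of `f_K`. -/
noncomputable def truncatedTrace (f : TensorField n m (CompDistr n)) (φ : Test n)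
    (I K : Fin m → Fin n) : Test n :=
  (∑ l : Fin (m / 2 + 1), coeff n l m • metricTrace l (two_mul_le_of_fin l)
    (fun I K => cutoffNormal (cutoff (f K)) I K φ) I : (Fin m → Fin n) → Test n) K

theorem truncatedTrace_apply (f : TensorField n m (CompDistr n)) (φ : Test n)
    (I K : Fin m → Fin n) (x : Euc n) : truncatedTrace f φ I K x = cutoff (f K) x *
      lineAvg (fun ξ => monomial (ξ : Euc n) K * traceSum (ξ : Euc n) I) φ x := by
  let e : ((Fin m → Fin n) → Test n) →ₗ[ℝ] ℝ :=
    { toFun := fun u => u K x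
      map_add' := fun _ _ => rfl
      map_smul' := fun _ _ => rfl }
  have h (I : Fin m → Fin n) : e (fun K => cutoffNormal (cutoff (f K)) I K φ) =
      cutoff (f K) x • lineAvg (fun ξ => monomial (ξ : Euc n) K * monomial (ξ : Euc n) I) φ x := by
    rw [← normalTest_single]
    rfl
  change e (∑ l : Fin (m / 2 + 1), coeff n l m • metricTrace l (two_mul_le_of_fin l)
    (fun I K => cutoffNormal (cutoff (f K)) I K φ) I) = _
  rw [map_sum]
  simp only [map_smul, map_metricTrace, h, metricTrace_smul]
  rw [← sum_coeff_metricTrace_lineAvg, Finset.mul_sum]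
  exact Finset.sum_congr rfl fun l _ => by simp only [smul_eq_mul]; ring

theorem sum_coeff_metricTrace_normalOp_apply (f : TensorField n m (CompDistr n)) (φ : Test n)
    (I : Fin m → Fin n) :
    ∑ l : Fin (m / 2 + 1), coeff n l m •
      metricTrace l (two_mul_le_of_fin l) (normalOp f) I φ =
      tensorPairing f (truncatedTrace f φ I) := by
  have h (I : Fin m → Fin n) : evalDistr φ (normalOp f I) =
      tensorPairing f (fun K => cutoffNormal (cutoff (f K)) I K φ) := by
    rw [tensorPairing_apply]
    exact normalOp_apply f I φ
  have h1 (l : Fin (m / 2 + 1)) : metricTrace l (two_mul_le_of_fin l) (normalOp f) I φ =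
      tensorPairing f (metricTrace l (two_mul_le_of_fin l)
        (fun I K => cutoffNormal (cutoff (f K)) I K φ) I) := by
    rw [map_metricTrace]
    simp only [← h]
    exact map_metricTrace (evalDistr φ) (two_mul_le_of_fin l) (normalOp f) I
  simp only [h1, ← map_smul]
  rw [← map_sum]
  rfl

/-- The form that `alternateAll_lineAvg_traceSum` takes for the cut-off averages. -/
theorem alternateAll_truncatedTrace (f : TensorField n m (CompDistr n)) (ψ : Test n)
    (I J : Fin m → Fin n) :
    alternateAll (fun I J => truncatedTrace f (iterOp (fun i => partialTest i) J ψ) I) I J =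
    alternateAll (fun I J K => (permCount I K : ℝ) • mulSmooth (cutoff (f K)) _
      (contDiff_lineAvg_one (iterOp (fun i => partialTest i) J ψ))) I J := by
  funext K
  ext x
  let e : ((Fin m → Fin n) → Test n) →ₗ[ℝ] ℝ :=
    { toFun := fun u => u K x
      map_add' := fun _ _ => rfl
      map_smul' := fun _ _ => rfl }
  change e _ = e _
  rw [map_alternateAll, map_alternateAll]
  have h := congrArg (cutoff (f K) x • ·) (alternateAll_lineAvg_traceSum ψ K x I J)
  simp only [← alternateAll_smul] at h
  refine Eq.trans ?_ (h.trans ?_)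
  · congr 1
    funext I J
    exact truncatedTrace_apply f _ I K x
  · congr 1
    funext I J
    change cutoff (f K) x * ((permCount I K : ℝ) * _) = (permCount I K : ℝ) * (cutoff (f K) x * _)
    ring

theorem tensorPairing_permCount (f : TensorField n m (CompDistr n)) (hf : IsSymm f) (φ : Test n)
    (I : Fin m → Fin n) :
    tensorPairing f (fun K => (permCount I K : ℝ) • mulSmooth (cutoff (f K)) _
      (contDiff_lineAvg_one φ)) = (m.factorial : ℝ) • pair (f I) _ (contDiff_lineAvg_one φ) := by
  have h := sum_permCount_smul (fun K => pair (f K) _ (contDiff_lineAvg_one φ))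
    (fun π K => by simp only [hf π K]) I
  rw [tensorPairing_apply, Nat.cast_smul_eq_nsmul, ← h]
  refine Finset.sum_congr rfl fun K _ => ?_
  rw [map_smul, Nat.cast_smul_eq_nsmul]
  rfl

end Main

end RayTensor

open RayTensor in
theorem proposition3p2 (n m : ℕ) (f : TensorField n m (CompDistr n)) (hf : IsSymm f)
    (I J : Fin m → Fin n) :
    (m.factorial : ℝ) • scalarNormalOp (saintVenant f I J) =
      ∑ l : Fin (m / 2 + 1), coeff n l m •
        saintVenant (metricTrace l (by omega) (normalOp f)) I J := by
  refine DFunLike.ext _ _ fun ψ => ?_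
  suffices h : evalDistr ψ ((m.factorial : ℝ) • scalarNormalOp (saintVenant f I J)) =
      evalDistr ψ (∑ l : Fin (m / 2 + 1), coeff n l m •
        saintVenant (metricTrace l (two_mul_le_of_fin l) (normalOp f)) I J) from h
  rw [map_smul, map_sum]
  have hl : evalDistr ψ (scalarNormalOp (saintVenant f I J)) =
      alternateAll (fun I J => (-1 : ℝ) ^ m • pair (f I) _
        (contDiff_lineAvg_one (iterOp (fun i => partialTest i) J ψ))) I J := by
    refine (scalarNormalOp_apply _ ψ).trans ?_
    change pairLin _ (contDiff_lineAvg_one ψ) _ = _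
    rw [saintVenant_eq, map_alternateAll]
    congr 1
    funext I J
    exact pair_iterOp_lineAvg (f I) ψ J
  have hr (l : Fin (m / 2 + 1)) :
      evalDistr ψ (coeff n l m •
        saintVenant (metricTrace l (two_mul_le_of_fin l) (normalOp f)) I J) =
      (-1 : ℝ) ^ m • alternateAll (fun I J => coeff n l m •
        metricTrace l (two_mul_le_of_fin l) (normalOp f) I
          (iterOp (fun i => partialTest i) J ψ)) I J := by
    rw [saintVenant_eq, map_smul, map_alternateAll, ← alternateAll_smul, ← alternateAll_smul]
    congr 1
    funext I J
    rw [smul_comm]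
    exact congrArg _ (iterOp_distr_apply _ ψ J)
  have hsum : ∑ l : Fin (m / 2 + 1), alternateAll (fun I J => coeff n l m •
        metricTrace l (two_mul_le_of_fin l) (normalOp f) I
          (iterOp (fun i => partialTest i) J ψ)) I J =
      alternateAll (fun I J => tensorPairing f
        (truncatedTrace f (iterOp (fun i => partialTest i) J ψ) I)) I J := by
    simp only [← sum_coeff_metricTrace_normalOp_apply, alternateAll_sum]
  rw [hl]
  simp only [hr]
  rw [← Finset.smul_sum, hsum, ← map_alternateAll, alternateAll_truncatedTrace, map_alternateAll]
  simp only [tensorPairing_permCount f hf, alternateAll_smul]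
  exact smul_comm _ _ _
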